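/- For a set $X\subseteq\omega$ let $\mathcal{O}^X$ be Kleene's $\mathcal{O}$ relativized to $X$ (the set of ordinal notations relative to $X$, the canonical $\Pi^1_1(X)$-complete set), and let $\mathcal{O}^\Box$ be the functional $X\mapsto\mathcal{O}^X$. For an ordinal $\alpha$ let $L_\alpha$ be the $\alpha$-th level of the constructible hierarchy. Call $\alpha$ \emph{$\Sigma^1_1$-pointwise-definable} if for every $a\in L_\alpha$ there is a parameter-free $\Sigma^1_1$ formula $\varphi_a(x)\equiv\exists X\,\psi(X,x)$ in the language of set theory, with $\psi$ first-order, such that $a$ is the unique element of $L_\alpha$ satisfying $\varphi_a$ in $(L_\alpha;\in)$. Here $\exists X$ is a true second-order quantifier (a finite block of quantifiers over arbitrary relations on $L_\alpha$, not only definable ones). \textbf{Theorem.} If $\alpha$ is a $\Sigma^1_1$-pointwise-definable ordinal, then $\mathcal{O}^\Box$ clarifies the class of copies of $\alpha$; that is, whenever $\mathfrak{A}=(\omega;<_{\mathfrak A})$ and $\mathfrak{B}=(\omega;<_{\mathfrak B})$ are linear orders with domain $\omega$, both isomorphic to $(\alpha;<)$, there is an isomorphism $i:\mathfrak{A}\cong\mathfrak{B}$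 that is computable from $\mathcal{O}^{\mathfrak{A}}\oplus\mathcal{O}^{\mathfrak{B}}$, where a structure with domain $\omega$ is identified with its atomic diagram, a subset of $\omega$. -/

import Mathlib

universe u

/-! ### Computation relative to a set of natural numbers -/

/-- A code for the finite initial segment of length `k` of the characteristic function of `X`. -/
noncomputable def oraclePrefix (X : Set ℕ) (k : ℕ) : ℕ :=
  open Classical in Encodable.encode ((List.range k).map fun i => decide (i ∈ X))

/-- The standard numbering of the partial functions computable from `X`: on input `n`, the
`e`-th program searches for a length `k` and a number `t` of steps such that the `e`-th ordinary
program halts within `t` steps on the pair (initial segment of `X` of length `k`, `n`), and returns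
the first output that it finds. -/
noncomputable def oraclePhi (X : Set ℕ) (e : ℕ) : ℕ →. ℕ := fun n =>
  Nat.rfindOpt fun m =>
    Nat.Partrec.Code.evaln m.unpair.2 (Nat.Partrec.Code.ofNatCode e)
      (Nat.pair (oraclePrefix X m.unpair.1) n)

/-- The characteristic function of a set of natural numbers, as an oracle. -/
noncomputable def charOracle (X : Set ℕ) : ℕ →. ℕ := fun n =>
  open Classical in Part.some (if n ∈ X then 1 else 0)

/-- The join `X ⊕ Y`. -/
def setJoin (X Y : Set ℕ) : Set ℕ :=
  {n | (∃ m ∈ X, n = 2 * m) ∨ ∃ m ∈ Y, n = 2 * m + 1}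

/-! ### Kleene's `𝒪`, relative to a set of natural numbers -/

/-- Kleene's relation `a <_𝒪 b` between ordinal notations, relative to `X`: the number `1` denotes
`0`, the number `2 ^ b` denotes the successor of what `b` denotes, and `3 * 5 ^ e` denotes the limit
of what the values of the `e`-th `X`-computable function denote, if that function is total and
increasing with respect to `<_𝒪`. -/
inductive KleeneLT (X : Set ℕ) : ℕ → ℕ → Prop
  | zero_lt : KleeneLT X 1 2
  | lt_succ {a b : ℕ} : KleeneLT X a b → KleeneLT X b (2 ^ b)
  | lt_lim (e : ℕ) (f : ℕ → ℕ) (hf : ∀ n, f n ∈ oraclePhi X e n)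
      (hlt : ∀ n, KleeneLT X (f n) (f (n + 1))) (n : ℕ) : KleeneLT X (f n) (3 * 5 ^ e)
  | trans {a b c : ℕ} : KleeneLT X a b → KleeneLT X b c → KleeneLT X a c

/-- Kleene's set of ordinal notations relative to `X`, that is, the field of `<_𝒪`. -/
def kleeneO (X : Set ℕ) : Set ℕ :=
  {a | ∃ b, KleeneLT X a b ∨ KleeneLT X b a}

/-! ### Structures with domain `ℕ` and clarification -/

/-- The atomic diagram of the structure `(ℕ; r)`. -/
def atomicDiagram (r : ℕ → ℕ → Prop) : Set ℕ :=
  {n | r n.unpair.1 n.unpair.2}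

/-- The functional `F` clarifies the class `K` of structures with one binary relation and domain
`ℕ`: any two isomorphic members `A`, `B` of `K` have an isomorphism computable from
`F(A) ⊕ F(B)`. -/
def Clarifies (F : Set ℕ → Set ℕ) (K : Set (ℕ → ℕ → Prop)) : Prop :=
  ∀ r ∈ K, ∀ s ∈ K, Nonempty (r ≃r s) →
    ∃ i : r ≃r s,
      ComputableIn {charOracle (setJoin (F (atomicDiagram r)) (F (atomicDiagram s)))}
        (fun n : ℕ => i n)

/-- The copies of the ordinal `α` with domain `ℕ`. -/
def copiesOf (α : Ordinal.{u}) : Set (ℕ → ℕ → Prop) :=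
  {r | Nonempty (r ≃r fun a b : Set.Iio α => a < b)}

/-! ### The constructible hierarchy -/

/-- The relation symbols of the language of set theory. -/
inductive MemSymbol : ℕ → Type
  | mem : MemSymbol 2

/-- The language of set theory. -/
def setLang : FirstOrder.Language.{0, 0} := ⟨fun _ => Empty, MemSymbol⟩

/-- A set `M`, regarded as the structure `(M; ∈)`. -/
instance memStructure (M : ZFSet.{u}) : setLang.Structure M where
  funMap f := nomatch f
  RelMap := fun
    | MemSymbol.mem, v => (v 0 : ZFSet.{u}) ∈ (v 1 : ZFSet.{u})

/-- The set of subsets of `M` that are first-order definable with parameters in `(M; ∈)`. -/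
noncomputable def definablePowerset (M : ZFSet.{u}) : ZFSet.{u} :=
  (ZFSet.powerset M).sep fun y =>
    (Set.univ : Set M).Definable₁ setLang {a : M | (a : ZFSet.{u}) ∈ y}

/-- The levels of the constructible hierarchy: `L_α` is the union of the sets of definable subsets
of `L_β`, over all `β < α`. -/
noncomputable def constructibleLevel (α : Ordinal.{u}) : ZFSet.{u} :=
  ZFSet.iUnion fun β : Set.Iio α => definablePowerset (constructibleLevel β)
termination_by α
decreasing_by exact β.2

/-! ### `Σ¹₁` formulas and pointwise definability -/

/-- The language of the second-order (relation) variables: countably many of each arity. -/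
def relVarLang : FirstOrder.Language.{0, 0} := ⟨fun _ => Empty, fun _ => ℕ⟩

/-- A `Σ¹₁` formula `∃ X, ψ(X, x)` in the language of set theory is given by its first-order matrix
`ψ`, in which finitely many relation variables can occur. It holds of `a` in `(M; ∈)` if `ψ` does
under some assignment of arbitrary relations on `M` to the relation variables. -/
def Sigma11Holds (M : ZFSet.{u}) (ψ : (setLang.sum relVarLang).Formula Unit) (a : M) : Prop :=
  ∃ _X : relVarLang.Structure M, ψ.Realize fun _ => a

/-- Every element of `M` is the only solution in `(M; ∈)` of some parameter-free `Σ¹₁` formula. -/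
def Sigma11PointwiseDefinable (M : ZFSet.{u}) : Prop :=
  ∀ a : M, ∃ ψ : (setLang.sum relVarLang).Formula Unit, {b : M | Sigma11Holds M ψ b} = {a}

/-- An ordinal `α` is `Σ¹₁`-pointwise-definable if `L_α` is. -/
def OrdinalSigma11PD (α : Ordinal.{u}) : Prop :=
  Sigma11PointwiseDefinable (constructibleLevel α)

/-! Fix copies `A` and `B` of `α`. The isomorphism sends `n` to the element `m` of `B` that
represents the same ordinal `β < α`. Each `L_β` is an element of `L_α` and `β ↦ L_β` is injective,
so pointwise definability yields a `Σ¹₁` formula `p` that holds in `L_α` of `L_β` and of no other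
level. Given `n`, one searches for a pair `(p, m)` such that `p` holds at `n` in `A`, `p` holds at
no other element of `A`, and `p` holds at `m` in `B`. Any such pair has the right `m`, since truth
of `p` at a level depends only on the ordinal and not on the copy.

Two facts make the search effective in `𝒪^A ⊕ 𝒪^B`.

The first is that `𝒪^X` is `Π¹₁(X)`-hard, uniformly in `X` (`exists_reduction_kleeneO`): a tree of
finite sequences is turned into a candidate notation, which is a genuine notation exactly when the
tree has no infinite path.

The second is that `Σ¹₁` truth in `L_α` at the level represented by `n` is a `Σ¹₁` property of any
copy (`exists_truth_iff`). It says that some function codes a hierarchy on `ℕ` ranked by the copy,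
together with the second-order witnesses and the satisfaction relations of all levels; these
conditions are arithmetical (`arith_isHierarchy`). Since the ranks lie in a true well-order, every
such hierarchy collapses onto `L_α` (`collapse_range`), and one exists because `L_α` is countably
infinite (`exists_isHierarchy`). Hence the three conditions of the search are `Σ¹₁(A)`, `Π¹₁(A)` and
`Σ¹₁(B)`. -/

/-! ### `Σ¹₁` relations in normal form -/

/-- The list of the first `k` values of `f`. -/
def restr {β : Type*} (f : ℕ → β) (k : ℕ) : List β := (List.range k).map f

@[simp] theorem length_restr {β : Type*} (f : ℕ → β) (k : ℕ) : (restr f k).length = k := by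
  simp [restr]

theorem getElem?_restr {β : Type*} (f : ℕ → β) (k i : ℕ) :
    (restr f k)[i]? = if i < k then some (f i) else none := by
  simp only [restr, List.getElem?_map]
  split_ifs with h
  · simp [h]
  · simp [h]

theorem restr_succ {β : Type*} (f : ℕ → β) (k : ℕ) : restr f (k + 1) = restr f k ++ [f k] := by
  simp [restr, List.range_succ]

/-- The list of the entries of `l` at the positions `g 0, …, g (k - 1)`. -/
def reindex {β : Type*} [Inhabited β] (l : List β) (g : ℕ → ℕ) (k : ℕ) : List β :=
  (List.range k).map fun i => l.getD (g i) default

theorem reindex_restr {β : Type*} [Inhabited β] (f : ℕ → β) {g : ℕ → ℕ} {k m : ℕ}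
    (h : ∀ i < k, g i < m) : reindex (restr f m) g k = restr (fun i => f (g i)) k := by
  refine List.map_congr_left fun i hi => ?_
  rw [List.getD_eq_getElem?_getD, getElem?_restr, if_pos (h i (List.mem_range.1 hi))]
  rfl

theorem Primrec.reindex {α β : Type*} [Primcodable α] [Primcodable β] [Inhabited β]
    {l : α → List β} {g : α → ℕ → ℕ} {k : α → ℕ} (hl : Primrec l) (hg : Primrec₂ g)
    (hk : Primrec k) : Primrec fun a => reindex (l a) (g a) (k a) :=
  Primrec.list_map (Primrec.list_range.comp hk)
    ((Primrec.list_getD (default : β)).comp (hl.comp Primrec.fst) hg)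

open Classical in
/-- The characteristic function of a set. -/
noncomputable def charB (A : Set ℕ) (i : ℕ) : Bool := decide (i ∈ A)

/-- A relation is `Σ¹₁` if it holds when some function `H` passes all the primitive recursive
tests of the finite initial segments of the oracles and of `H`. -/
def Sig {α : Type*} [Primcodable α] (R : Set ℕ → (ℕ → ℕ) → α → Prop) : Prop :=
  ∃ c : α → List Bool → List ℕ → List ℕ → Bool,
    (Primrec fun x : α × List Bool × List ℕ × List ℕ => c x.1 x.2.1 x.2.2.1 x.2.2.2) ∧
    ∀ A G a, R A G a ↔
      ∃ H : ℕ → ℕ, ∀ k, c a (restr (charB A) k) (restr G k) (restr H k) = true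

section Sig

variable {α β : Type*} [Primcodable α] [Primcodable β]

theorem Primrec.test {γ : Type*} [Primcodable γ] {c : α → List Bool → List ℕ → List ℕ → Bool}
    (hc : Primrec fun x : α × List Bool × List ℕ × List ℕ => c x.1 x.2.1 x.2.2.1 x.2.2.2)
    {f : γ → α} {l : γ → List Bool} {l' l'' : γ → List ℕ} (hf : Primrec f) (hl : Primrec l)
    (hl' : Primrec l') (hl'' : Primrec l'') : Primrec fun x => c (f x) (l x) (l' x) (l'' x) :=
  hc.comp (hf.pair (hl.pair (hl'.pair hl'')))

theorem Sig.of_iff {R S : Set ℕ → (ℕ → ℕ) → α → Prop} (h : Sig R)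
    (H : ∀ A G a, S A G a ↔ R A G a) : Sig S := by
  obtain ⟨c, hc, h⟩ := h
  exact ⟨c, hc, fun A G a => (H A G a).trans (h A G a)⟩

theorem Sig.comp {R : Set ℕ → (ℕ → ℕ) → β → Prop} (h : Sig R) {f : α → β} (hf : Primrec f) :
    Sig fun A G a => R A G (f a) := by
  obtain ⟨c, hc, h⟩ := h
  exact ⟨fun a => c (f a), Primrec.test hc (hf.comp .fst) (Primrec.fst.comp .snd)
    (Primrec.fst.comp (Primrec.snd.comp .snd)) (Primrec.snd.comp (Primrec.snd.comp .snd)),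
    fun A G a => h A G (f a)⟩

theorem Sig.cond {R S : Set ℕ → (ℕ → ℕ) → α → Prop} (hR : Sig R) (hS : Sig S) {p : α → Bool}
    (hp : Primrec p) : Sig fun A G a => bif p a then R A G a else S A G a := by
  obtain ⟨c, hc, hR⟩ := hR
  obtain ⟨d, hd, hS⟩ := hS
  refine ⟨fun a l m n => bif p a then c a l m n else d a l m n,
    Primrec.cond (hp.comp .fst) hc hd, fun A G a => ?_⟩
  dsimp only
  cases p a
  · exact hS A G a
  · exact hR A G a

theorem Sig.pred {p : α → Bool} (hp : Primrec p) : Sig fun _ _ a => p a = true :=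
  ⟨fun a _ _ _ => p a, hp.comp .fst, fun _ _ a => by simp⟩

theorem Sig.oracle_mem {f : α → ℕ} (hf : Primrec f) (b : Bool) :
    Sig fun A _ a => charB A (f a) = b := by
  -- The default `b` lets every segment too short to reach position `f a` pass; the segment of
  -- length `f a + 1` decides.
  refine ⟨fun a l _ _ => (l[f a]?).getD b == b, ?_, fun A G a => ?_⟩
  · exact Primrec.beq.comp (Primrec.option_getD.comp
      (Primrec.list_getElem?.comp (Primrec.fst.comp .snd) (hf.comp .fst)) (.const b)) (.const b)
  · constructor
    · intro h
      refine ⟨id, fun k => ?_⟩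
      dsimp only
      rw [getElem?_restr]
      split_ifs <;> simp [h]
    · rintro ⟨H, h⟩
      have := h (f a + 1)
      dsimp only at this
      rw [getElem?_restr, if_pos (Nat.lt_succ_self _)] at this
      simpa using this

theorem Sig.oracle_eq {f g : α → ℕ} (hf : Primrec f) (hg : Primrec g) :
    Sig fun _ G a => G (f a) = g a := by
  refine ⟨fun a _ l _ => (l[f a]?).getD (g a) == g a, ?_, fun A G a => ?_⟩
  · exact Primrec.beq.comp (Primrec.option_getD.comp
      (Primrec.list_getElem?.comp (Primrec.fst.comp (Primrec.snd.comp .snd)) (hf.comp .fst))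
      (hg.comp .fst)) (hg.comp .fst)
  · constructor
    · intro h
      refine ⟨id, fun k => ?_⟩
      dsimp only
      rw [getElem?_restr]
      split_ifs <;> simp [h]
    · rintro ⟨H, h⟩
      have := h (f a + 1)
      dsimp only at this
      rw [getElem?_restr, if_pos (Nat.lt_succ_self _)] at this
      simpa using this

theorem Sig.oracle_ne {f g : α → ℕ} (hf : Primrec f) (hg : Primrec g) :
    Sig fun _ G a => G (f a) ≠ g a := by
  -- The default `g a + 1` differs from `g a`, so short segments pass.
  refine ⟨fun a _ l _ => !((l[f a]?).getD (g a + 1) == g a), ?_, fun A G a => ?_⟩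
  · exact Primrec.not.comp (Primrec.beq.comp (Primrec.option_getD.comp
      (Primrec.list_getElem?.comp (Primrec.fst.comp (Primrec.snd.comp .snd)) (hf.comp .fst))
      (Primrec.succ.comp (hg.comp .fst))) (hg.comp .fst))
  · constructor
    · intro h
      refine ⟨id, fun k => ?_⟩
      dsimp only
      rw [getElem?_restr]
      split_ifs <;> simp [h]
    · rintro ⟨H, h⟩
      have := h (f a + 1)
      dsimp only at this
      rw [getElem?_restr, if_pos (Nat.lt_succ_self _)] at this
      simpa using this

/-- Countably many witnesses are merged into one function `F`, the witness for `b` being the column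
`i ↦ F ⟨code of b, i⟩`. The test at length `⟨n, k⟩` runs the `k`-th test for the `b` with code `n`;
the positions `⟨n, i⟩` with `i < k` that it reads are below `⟨n, k⟩`. -/
theorem Sig.forall {R : Set ℕ → (ℕ → ℕ) → α → β → Prop}
    (h : Sig fun A G (x : α × β) => R A G x.1 x.2) : Sig fun A G a => ∀ b, R A G a b := by
  obtain ⟨c, hc, h⟩ := h
  let d : α → List Bool → List ℕ → List ℕ → Bool := fun a l m n =>
    Option.casesOn (Encodable.decode (α := β) n.length.unpair.1) true fun b =>
      c (a, b) (reindex l id n.length.unpair.2) (reindex m id n.length.unpair.2)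
        (reindex n (fun i => Nat.pair n.length.unpair.1 i) n.length.unpair.2)
  refine ⟨d, ?_, fun A G a => ?_⟩
  · have h1 : Primrec fun x : α × List Bool × List ℕ × List ℕ => x.2.2.2.length :=
      Primrec.list_length.comp (Primrec.snd.comp (Primrec.snd.comp .snd))
    have h2 := Primrec.fst.comp (Primrec.unpair.comp h1)
    have h3 := Primrec.snd.comp (Primrec.unpair.comp h1)
    refine Primrec.option_casesOn (Primrec.decode.comp h2) (.const true) ?_
    refine Primrec.test hc ((Primrec.fst.comp .fst).pair .snd)
      (Primrec.reindex (Primrec.fst.comp (Primrec.snd.comp .fst)) .snd (h3.comp .fst))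
      (Primrec.reindex (Primrec.fst.comp (Primrec.snd.comp (Primrec.snd.comp .fst))) .snd
        (h3.comp .fst))
      (Primrec.reindex (Primrec.snd.comp (Primrec.snd.comp (Primrec.snd.comp .fst))) ?_
        (h3.comp .fst))
    exact Primrec₂.natPair.comp (h2.comp (Primrec.fst.comp .fst)) .snd
  · have key : ∀ (F : ℕ → ℕ) (n : ℕ) (b : β) (k : ℕ), Encodable.decode n = some b →
        d a (restr (charB A) (Nat.pair n k)) (restr G (Nat.pair n k)) (restr F (Nat.pair n k)) =
        c (a, b) (restr (charB A) k) (restr G k) (restr (fun i => F (Nat.pair n i)) k) := by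
      intro F n b k hb
      have h0 : ∀ i < k, id i < Nat.pair n k := fun i hi => hi.trans_le (Nat.right_le_pair _ _)
      simp only [d, length_restr, Nat.unpair_pair, hb]
      rw [reindex_restr _ h0, reindex_restr _ h0,
        reindex_restr F fun i hi => Nat.pair_lt_pair_right _ hi]
      rfl
    constructor
    · intro hR
      choose H hH using fun b => (h A G (a, b)).1 (hR b)
      refine ⟨fun i => Option.casesOn (Encodable.decode (α := β) i.unpair.1) 0
        fun b => H b i.unpair.2, fun m => ?_⟩
      rcases hm : Encodable.decode (α := β) m.unpair.1 with _ | b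
      · simp [d, hm]
      · rw [← Nat.pair_unpair m, key _ _ b _ hm]
        simpa [hm] using hH b m.unpair.2
    · rintro ⟨F, hF⟩ b
      exact (h A G (a, b)).2
        ⟨_, fun k => (key F _ b k (Encodable.encodek b)).symm.trans (hF _)⟩

/-- `F 0` stores the code of the chosen `b` and the remaining values of `F` form the witness for it,
so lengths shift by one. The empty segment passes, while an `F 0` that codes nothing fails. -/
theorem Sig.exists {R : Set ℕ → (ℕ → ℕ) → α → β → Prop}
    (h : Sig fun A G (x : α × β) => R A G x.1 x.2) : Sig fun A G a => ∃ b, R A G a b := by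
  obtain ⟨c, hc, h⟩ := h
  let d : α → List Bool → List ℕ → List ℕ → Bool := fun a l m n =>
    Option.casesOn n.head? true fun i =>
      Option.casesOn (Encodable.decode (α := β) i) false fun b =>
        c (a, b) (reindex l id n.length.pred) (reindex m id n.length.pred)
          (reindex n Nat.succ n.length.pred)
  refine ⟨d, ?_, fun A G a => ?_⟩
  · have h1 : Primrec fun x : α × List Bool × List ℕ × List ℕ => x.2.2.2.length.pred :=
      Primrec.pred.comp (Primrec.list_length.comp (Primrec.snd.comp (Primrec.snd.comp .snd)))
    refine Primrec.option_casesOn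
      (Primrec.list_head?.comp (Primrec.snd.comp (Primrec.snd.comp .snd))) (.const true) ?_
    refine Primrec.option_casesOn (Primrec.decode.comp .snd) (.const false) ?_
    have h2 : Primrec fun x : ((α × List Bool × List ℕ × List ℕ) × ℕ) × β => x.1.1 :=
      Primrec.fst.comp .fst
    have h3 := Primrec.snd.comp h2
    have h4 := Primrec.snd.comp h3
    exact Primrec.test hc ((Primrec.fst.comp h2).pair .snd)
      (Primrec.reindex (Primrec.fst.comp h3) .snd (h1.comp h2))
      (Primrec.reindex (Primrec.fst.comp h4) .snd (h1.comp h2))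
      (Primrec.reindex (Primrec.snd.comp h4) (Primrec.succ.comp .snd) (h1.comp h2))
  · have key : ∀ (F : ℕ → ℕ) (b : β) (k : ℕ), Encodable.decode (F 0) = some b →
        d a (restr (charB A) (k + 1)) (restr G (k + 1)) (restr F (k + 1)) =
        c (a, b) (restr (charB A) k) (restr G k) (restr (fun i => F (i + 1)) k) := by
      intro F b k hb
      have h0 : ∀ i < k, id i < k + 1 := fun i hi => hi.trans (Nat.lt_succ_self _)
      have h1 : (restr F (k + 1)).head? = some (F 0) := by
        rw [List.head?_eq_getElem?, getElem?_restr, if_pos (Nat.succ_pos _)]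
      simp only [d, length_restr, h1, hb, Nat.pred_succ]
      rw [reindex_restr _ h0, reindex_restr _ h0,
        reindex_restr F fun i hi => Nat.succ_lt_succ hi]
      rfl
    constructor
    · rintro ⟨b, hR⟩
      obtain ⟨H, hH⟩ := (h A G (a, b)).1 hR
      refine ⟨fun i => Nat.casesOn i (Encodable.encode b) H, fun m => ?_⟩
      cases m with
      | zero => rfl
      | succ k => rw [key _ b k (Encodable.encodek b)]; exact hH k
    · rintro ⟨F, hF⟩
      rcases hb : Encodable.decode (α := β) (F 0) with _ | b
      · have := hF 1
        simp [d, restr, hb] at this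
      · exact ⟨b, (h A G (a, b)).2 ⟨_, fun k => (key F b k hb).symm.trans (hF _)⟩⟩

theorem Sig.and {R S : Set ℕ → (ℕ → ℕ) → α → Prop} (hR : Sig R) (hS : Sig S) :
    Sig fun A G a => R A G a ∧ S A G a :=
  (Sig.forall (R := fun A G a (b : Bool) => bif b then R A G a else S A G a)
    ((hR.comp .fst).cond (hS.comp .fst) .snd)).of_iff fun A G a => by
    simp [and_comm]

theorem Sig.or {R S : Set ℕ → (ℕ → ℕ) → α → Prop} (hR : Sig R) (hS : Sig S) :
    Sig fun A G a => R A G a ∨ S A G a :=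
  (Sig.exists (R := fun A G a (b : Bool) => bif b then R A G a else S A G a)
    ((hR.comp .fst).cond (hS.comp .fst) .snd)).of_iff fun A G a => by
    simp [or_comm]

/-- A `Σ¹₁` relation without a free function variable, in normal form. -/
theorem Sig.exists_oracle {R : Set ℕ → (ℕ → ℕ) → α → Prop} (h : Sig R) :
    ∃ c : α → List Bool → List ℕ → Bool,
      (Primrec fun x : α × List Bool × List ℕ => c x.1 x.2.1 x.2.2) ∧
      ∀ A a, (∃ G, R A G a) ↔ ∃ F : ℕ → ℕ, ∀ k, c a (restr (charB A) k) (restr F k) = true := by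
  obtain ⟨c, hc, h⟩ := h
  -- `G` sits at the even positions of `F` and `H` at the odd ones; a segment of length `m`
  -- determines `m / 2` values of each.
  let d : α → List Bool → List ℕ → Bool := fun a l n =>
    c a (reindex l id n.length.div2) (reindex n (fun i => 2 * i) n.length.div2)
      (reindex n (fun i => 2 * i + 1) n.length.div2)
  refine ⟨d, ?_, fun A a => ?_⟩
  · have h1 : Primrec fun x : α × List Bool × List ℕ => x.2.2.length.div2 :=
      Primrec.nat_div2.comp (Primrec.list_length.comp (Primrec.snd.comp .snd))
    have h2 : Primrec fun x : (α × List Bool × List ℕ) × ℕ => 2 * x.2 :=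
      Primrec.nat_mul.comp (.const 2) .snd
    exact Primrec.test hc .fst (Primrec.reindex (Primrec.fst.comp .snd) .snd h1)
      (Primrec.reindex (Primrec.snd.comp .snd) h2 h1)
      (Primrec.reindex (Primrec.snd.comp .snd) (Primrec.succ.comp h2) h1)
  · have key : ∀ (F : ℕ → ℕ) (m : ℕ), d a (restr (charB A) m) (restr F m) =
        c a (restr (charB A) m.div2) (restr (fun i => F (2 * i)) m.div2)
          (restr (fun i => F (2 * i + 1)) m.div2) := by
      intro F m
      simp only [d, length_restr]
      rw [reindex_restr, reindex_restr, reindex_restr]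
      · rfl
      all_goals
        intro i hi
        rw [Nat.div2_val] at hi
        try simp only [id]
        omega
    constructor
    · rintro ⟨G, hR⟩
      obtain ⟨H, hH⟩ := (h A G a).1 hR
      refine ⟨fun i => if i % 2 = 0 then G (i / 2) else H (i / 2), fun m => ?_⟩
      rw [key]
      convert hH m.div2 using 4 with i i
      · simp
      · have h1 : (2 * i + 1) / 2 = i := by omega
        simp [h1, Nat.add_mod]
    · rintro ⟨F, hF⟩
      refine ⟨fun i => F (2 * i), (h A _ a).2 ⟨fun i => F (2 * i + 1), fun k => ?_⟩⟩
      have := hF (2 * k)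
      rw [key] at this
      simpa [Nat.div2_val] using this

/-! ### Arithmetical relations -/

/-- A sufficient criterion for relations that are arithmetical in the oracles: both the relation
and its negation are `Σ¹₁`. -/
def Arith (R : Set ℕ → (ℕ → ℕ) → α → Prop) : Prop :=
  Sig R ∧ Sig fun A G a => ¬ R A G a

namespace Arith

variable {R S : Set ℕ → (ℕ → ℕ) → α → Prop}

theorem of_iff (h : Arith R) (H : ∀ A G a, S A G a ↔ R A G a) : Arith S :=
  ⟨h.1.of_iff H, h.2.of_iff fun A G a => not_congr (H A G a)⟩

theorem comp {R : Set ℕ → (ℕ → ℕ) → β → Prop} (h : Arith R) {f : α → β} (hf : Primrec f) :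
    Arith fun A G a => R A G (f a) :=
  ⟨h.1.comp hf, h.2.comp hf⟩

theorem not (h : Arith R) : Arith fun A G a => ¬ R A G a :=
  ⟨h.2, h.1.of_iff fun _ _ _ => not_not⟩

theorem and (hR : Arith R) (hS : Arith S) : Arith fun A G a => R A G a ∧ S A G a :=
  ⟨hR.1.and hS.1, (hR.2.or hS.2).of_iff fun _ _ _ => not_and_or⟩

theorem or (hR : Arith R) (hS : Arith S) : Arith fun A G a => R A G a ∨ S A G a :=
  ⟨hR.1.or hS.1, (hR.2.and hS.2).of_iff fun _ _ _ => not_or⟩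

theorem imp (hR : Arith R) (hS : Arith S) : Arith fun A G a => R A G a → S A G a :=
  (hR.not.or hS).of_iff fun _ _ _ => imp_iff_not_or

theorem iff (hR : Arith R) (hS : Arith S) : Arith fun A G a => (R A G a ↔ S A G a) :=
  ((hR.imp hS).and (hS.imp hR)).of_iff fun _ _ _ => iff_iff_implies_and_implies

theorem all {R : Set ℕ → (ℕ → ℕ) → α → β → Prop}
    (h : Arith fun A G (x : α × β) => R A G x.1 x.2) : Arith fun A G a => ∀ b, R A G a b :=
  ⟨Sig.forall h.1, (Sig.exists h.2).of_iff fun _ _ _ => not_forall⟩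

theorem ex {R : Set ℕ → (ℕ → ℕ) → α → β → Prop}
    (h : Arith fun A G (x : α × β) => R A G x.1 x.2) : Arith fun A G a => ∃ b, R A G a b :=
  ⟨Sig.exists h.1, (Sig.forall h.2).of_iff fun _ _ _ => not_exists⟩

theorem oracle_mem {f : α → ℕ} (hf : Primrec f) : Arith fun A _ a => f a ∈ A :=
  ⟨(Sig.oracle_mem hf true).of_iff fun _ _ _ => by simp [charB],
    (Sig.oracle_mem hf false).of_iff fun _ _ _ => by simp [charB]⟩

theorem oracle_eq {f g : α → ℕ} (hf : Primrec f) (hg : Primrec g) :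
    Arith fun _ G a => G (f a) = g a :=
  ⟨Sig.oracle_eq hf hg, Sig.oracle_ne hf hg⟩

theorem eq {f g : α → β} (hf : Primrec f) (hg : Primrec g) : Arith fun _ _ a => f a = g a := by
  classical
  have h : Primrec fun a => f a == g a := Primrec.beq.comp hf hg
  exact ⟨(Sig.pred h).of_iff fun _ _ _ => by simp,
    (Sig.pred (Primrec.not.comp h)).of_iff fun _ _ _ => by simp⟩

end Arith

end Sig

/-! ### Kleene's `𝒪` is `Π¹₁`-hard -/

open Nat.Partrec (Code)

theorem oraclePrefix_eq (X : Set ℕ) (k : ℕ) :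
    oraclePrefix X k = Encodable.encode (restr (charB X) k) := rfl

theorem oraclePhi_unique {X : Set ℕ} {e n a b : ℕ} (ha : a ∈ oraclePhi X e n)
    (hb : b ∈ oraclePhi X e n) : a = b := Part.mem_unique ha hb

/-- The search in `oraclePhi` stops at the first output it meets, over all prefix lengths and step
bounds. Its value is therefore controlled when the program diverges on short prefixes and gives one
and the same output on all longer ones. -/
theorem mem_oraclePhi {X : Set ℕ} {c : Code} {N n y : ℕ}
    (h : ∀ u, c.eval (Nat.pair (oraclePrefix X u) n) = if u ≤ N then Part.none else Part.some y) :
    y ∈ oraclePhi X (Encodable.encode c) n := by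
  have hc : Code.ofNatCode (Encodable.encode c) = c := by
    rw [← Code.ofNatCode_eq]; exact Denumerable.ofNat_encode c
  have hd : (oraclePhi X (Encodable.encode c) n).Dom := by
    rw [oraclePhi, Nat.rfindOpt_dom, hc]
    have : y ∈ c.eval (Nat.pair (oraclePrefix X (N + 1)) n) := by rw [h]; simp
    obtain ⟨t, ht⟩ := Code.evaln_complete.1 this
    exact ⟨Nat.pair (N + 1) t, y, by simpa using ht⟩
  obtain ⟨z, hz⟩ := Part.dom_iff_mem.1 hd
  obtain ⟨m, hm⟩ := Nat.rfindOpt_spec hz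
  rw [hc] at hm
  have := Code.evaln_sound hm
  rw [h] at this
  split_ifs at this
  · simp at this
  · rwa [Part.mem_some_iff.1 this] at hz

/-! ### Inversion and well-foundedness of `<_𝒪`. -/

namespace KleeneLT

variable {X : Set ℕ} {a b c : ℕ}

theorem pos_right (h : KleeneLT X a b) : 1 < b := by
  induction h with
  | zero_lt => omega
  | @lt_succ a b _ ih => exact Nat.one_lt_two_pow (by omega)
  | lt_lim e => have := Nat.pow_pos (n := e) (show 0 < 5 by omega); omega
  | trans _ _ _ ih => exact ih

theorem source (h : KleeneLT X a b) : a = 1 ∨ ∃ c, KleeneLT X c a := by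
  induction h with
  | zero_lt => exact .inl rfl
  | lt_succ h _ => exact .inr ⟨_, h⟩
  | lt_lim e f hf hlt n ih =>
    cases n with
    | zero => exact ih 0
    | succ n => exact .inr ⟨_, hlt n⟩
  | trans _ _ ih _ => exact ih

theorem three_mul_five_pow_ne_two_pow (e b : ℕ) : 3 * 5 ^ e ≠ 2 ^ b := by
  intro h
  have h3 : 3 ∣ 2 ^ b := h ▸ Dvd.intro _ rfl
  have := Nat.Prime.dvd_of_dvd_pow Nat.prime_three h3
  omega

/-- A power of two is never of the form `3 * 5 ^ e`, so the last step of a derivation is a successor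
step (with `2 = 2 ^ 1` for `zero_lt`) or an appeal to transitivity. -/
theorem of_lt_two_pow (h : KleeneLT X a (2 ^ b)) : a = b ∨ KleeneLT X a b := by
  generalize hc : 2 ^ b = c at h
  induction h with
  | zero_lt =>
    left
    exact (Nat.pow_right_injective (le_refl 2) (hc.trans (pow_one 2).symm)).symm
  | lt_succ h _ =>
    left
    exact (Nat.pow_right_injective (le_refl 2) hc).symm
  | lt_lim e => exact absurd hc.symm (three_mul_five_pow_ne_two_pow e b)
  | trans h1 _ _ ih =>
    rcases ih hc with rfl | h
    · exact .inr h1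
    · exact .inr (h1.trans h)

theorem of_lt_lim {e : ℕ} (h : KleeneLT X a (3 * 5 ^ e)) :
    ∃ f : ℕ → ℕ, (∀ n, f n ∈ oraclePhi X e n) ∧ (∀ n, KleeneLT X (f n) (f (n + 1))) ∧
      ∃ n, a = f n ∨ KleeneLT X a (f n) := by
  generalize hc : 3 * 5 ^ e = c at h
  induction h with
  | zero_lt => exact absurd hc (by simpa using three_mul_five_pow_ne_two_pow e 1)
  | lt_succ _ _ => exact absurd hc (three_mul_five_pow_ne_two_pow _ _)
  | lt_lim e' f hf hlt n =>
    have : e' = e := Nat.pow_right_injective (show 2 ≤ 5 by omega) (by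
      simp only; omega)
    subst this
    exact ⟨f, hf, hlt, n, .inl rfl⟩
  | trans h1 _ _ ih =>
    obtain ⟨f, hf, hlt, n, rfl | h⟩ := ih hc
    · exact ⟨f, hf, hlt, n, .inr h1⟩
    · exact ⟨f, hf, hlt, n, .inr (h1.trans h)⟩

theorem acc_one : Acc (KleeneLT X) 1 :=
  ⟨_, fun _ h => absurd h.pos_right (lt_irrefl 1)⟩

theorem acc_two_pow (h : Acc (KleeneLT X) b) : Acc (KleeneLT X) (2 ^ b) :=
  ⟨_, fun _ hy => by
    rcases hy.of_lt_two_pow with rfl | hy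
    · exact h
    · exact h.inv hy⟩

/-- Inversion reduces anything below a successor or a limit to notations already known to be
accessible; at a limit, the fundamental sequence is determined by the index. -/
theorem acc (h : KleeneLT X a b) : Acc (KleeneLT X) a ∧ Acc (KleeneLT X) b := by
  induction h with
  | zero_lt => exact ⟨acc_one, acc_two_pow acc_one⟩
  | lt_succ _ ih => exact ⟨ih.2, acc_two_pow ih.2⟩
  | lt_lim e f hf hlt n ih =>
    refine ⟨(ih n).1, ⟨_, fun y hy => ?_⟩⟩
    obtain ⟨f', hf', -, m, hm⟩ := hy.of_lt_lim
    rw [oraclePhi_unique (hf' m) (hf m)] at hm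
    rcases hm with rfl | hm
    · exact (ih m).1
    · exact (ih m).1.inv hm
  | trans _ _ ih1 ih2 => exact ⟨ih1.1, ih2.2⟩

end KleeneLT

theorem mem_kleeneO_iff {X : Set ℕ} {a : ℕ} : a ∈ kleeneO X ↔ a = 1 ∨ ∃ b, KleeneLT X b a := by
  constructor
  · rintro ⟨b, h | h⟩
    · exact h.source
    · exact .inr ⟨b, h⟩
  · rintro (rfl | ⟨b, h⟩)
    · exact ⟨2, .inl .zero_lt⟩
    · exact ⟨b, .inr h⟩

theorem lt_two_pow_of_mem_kleeneO {X : Set ℕ} {a : ℕ} (h : a ∈ kleeneO X) :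
    KleeneLT X a (2 ^ a) := by
  rcases mem_kleeneO_iff.1 h with rfl | ⟨b, h⟩
  · exact .zero_lt
  · exact .lt_succ h

theorem KleeneLT.mem_right {X : Set ℕ} {a b : ℕ} (h : KleeneLT X a b) : b ∈ kleeneO X :=
  ⟨a, .inr h⟩

/-! ### Ordinal notations built from trees. -/

section TreeNotation

variable {α : Type*} [Primcodable α]

/-- The notation obtained by stacking the tree above the node `σ` on top of the notation `b`, where
`cd` is a program for its fundamental sequence. -/
def treeNotation (cd : Code) (x : α) (σ : List ℕ) (b : ℕ) : ℕ :=
  3 * 5 ^ Encodable.encode (cd.curry (Encodable.encode (x, σ, b)))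

/-- The fundamental sequence of `treeNotation`: the subtrees above the children of `σ` are stacked
on top of each other. -/
def treeSeq (T : List ℕ → Bool) (cd : Code) (x : α) (σ : List ℕ) (b k : ℕ) : ℕ :=
  Nat.rec b (fun j y => bif T (σ ++ [j]) then treeNotation cd x (σ ++ [j]) y else 2 ^ y) k

theorem Primrec.nat_pow : Primrec₂ ((· ^ ·) : ℕ → ℕ → ℕ) :=
  Primrec₂.unpaired'.1 Nat.Primrec.pow

theorem primrec_treeNotation {γ : Type*} [Primcodable γ] {cd : γ → Code} {x : γ → α}
    {σ : γ → List ℕ} {b : γ → ℕ} (hcd : Primrec cd) (hx : Primrec x) (hσ : Primrec σ)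
    (hb : Primrec b) : Primrec fun z => treeNotation (cd z) (x z) (σ z) (b z) :=
  Primrec.nat_mul.comp (.const 3) (Primrec.nat_pow.comp (.const 5) (Primrec.encode.comp
    (Code.primrec₂_curry.comp hcd (Primrec.encode.comp (hx.pair (hσ.pair hb))))))

/-- The program for the fundamental sequences. -/
def treeProg (c : α → List Bool → List ℕ → Bool) (cd : Code) (z : ℕ) : Option ℕ :=
  (Encodable.decode (α := α × List ℕ × ℕ) z.unpair.1).bind fun p =>
    (Encodable.decode (α := List Bool) z.unpair.2.unpair.1).bind fun l =>
      (l[p.2.1.length]?).map fun _ =>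
        treeSeq (fun τ => c p.1 (l.take τ.length) τ) cd p.1 p.2.1 p.2.2 z.unpair.2.unpair.2

theorem primrec_treeSeq {c : α → List Bool → List ℕ → Bool}
    (hc : Primrec fun x : α × List Bool × List ℕ => c x.1 x.2.1 x.2.2) {γ : Type*} [Primcodable γ]
    {l : γ → List Bool} {cd : γ → Code} {x : γ → α} {σ : γ → List ℕ} {b k : γ → ℕ}
    (hl : Primrec l) (hcd : Primrec cd) (hx : Primrec x) (hσ : Primrec σ) (hb : Primrec b)
    (hk : Primrec k) : Primrec fun z =>
      treeSeq (fun τ => c (x z) ((l z).take τ.length) τ) (cd z) (x z) (σ z) (b z) (k z) := by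
  have hτ : Primrec fun q : γ × ℕ × ℕ => σ q.1 ++ [q.2.1] :=
    Primrec.list_concat.comp (hσ.comp .fst) (Primrec.fst.comp .snd)
  have hT : Primrec fun q : γ × ℕ × ℕ =>
      c (x q.1) ((l q.1).take (σ q.1 ++ [q.2.1]).length) (σ q.1 ++ [q.2.1]) :=
    hc.comp ((hx.comp .fst).pair (Primrec.pair
      (Primrec.list_take.comp (Primrec.list_length.comp hτ) (hl.comp .fst)) hτ))
  exact Primrec.nat_rec' hk hb (Primrec.cond hT
    (primrec_treeNotation (hcd.comp .fst) (hx.comp .fst) hτ (Primrec.snd.comp .snd))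
    (Primrec.nat_pow.comp (.const 2) (Primrec.snd.comp .snd))).to₂

theorem primrec_treeProg {c : α → List Bool → List ℕ → Bool}
    (hc : Primrec fun x : α × List Bool × List ℕ => c x.1 x.2.1 x.2.2) :
    Primrec₂ (treeProg c) := by
  have hz : Primrec fun q : Code × ℕ => q.2.unpair := Primrec.unpair.comp .snd
  have hz' : Primrec fun q : Code × ℕ => q.2.unpair.2.unpair :=
    Primrec.unpair.comp (Primrec.snd.comp hz)
  refine Primrec.option_bind (Primrec.decode.comp (Primrec.fst.comp hz)) ?_
  refine Primrec.option_bind (Primrec.decode.comp (Primrec.fst.comp (hz'.comp .fst))) ?_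
  have hp : Primrec fun q : ((Code × ℕ) × α × List ℕ × ℕ) × List Bool => q.1.2 :=
    Primrec.snd.comp .fst
  have hσ : Primrec fun q : ((Code × ℕ) × α × List ℕ × ℕ) × List Bool => q.1.2.2.1 :=
    Primrec.fst.comp (Primrec.snd.comp hp)
  refine Primrec.option_map
    (Primrec.list_getElem?.comp .snd (Primrec.list_length.comp hσ)) ?_
  have h1 : Primrec fun q : (((Code × ℕ) × α × List ℕ × ℕ) × List Bool) × Bool => q.1.1.1 :=
    Primrec.fst.comp (Primrec.fst.comp .fst)
  exact (primrec_treeSeq hc (Primrec.snd.comp .fst) (Primrec.fst.comp h1)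
    ((Primrec.fst.comp hp).comp .fst) (hσ.comp .fst)
    ((Primrec.snd.comp (Primrec.snd.comp hp)).comp .fst) (Primrec.snd.comp (hz'.comp h1))).to₂

theorem treeSeq_congr {T T' : List ℕ → Bool} {σ : List ℕ} (h : ∀ j, T (σ ++ [j]) = T' (σ ++ [j]))
    (cd : Code) (x : α) (b k : ℕ) : treeSeq T cd x σ b k = treeSeq T' cd x σ b k := by
  simp only [treeSeq, h]

theorem exists_treeNotation {c : α → List Bool → List ℕ → Bool}
    (hc : Primrec fun x : α × List Bool × List ℕ => c x.1 x.2.1 x.2.2) :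
    ∃ cd : Code, ∀ (X : Set ℕ) (x : α) (σ : List ℕ) (b k : ℕ),
      treeSeq (fun τ => c x (restr (charB X) τ.length) τ) cd x σ b k ∈
        oraclePhi X (Encodable.encode (cd.curry (Encodable.encode (x, σ, b)))) k := by
  -- The values of the fundamental sequence are notations that mention the program computing it, so
  -- the recursion theorem supplies its own code.
  obtain ⟨cd, hcd⟩ := Code.fixed_point₂ (f := fun cd z => (treeProg c cd z : Part ℕ))
    (Computable.ofOption (primrec_treeProg hc).to_comp)
  -- The program looks up entry `σ.length` of the prefix only to make sure that the prefix decides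
  -- which children of `σ`, of length `σ.length + 1`, pass the test.
  refine ⟨cd, fun X x σ b k => mem_oraclePhi (N := σ.length) fun u => ?_⟩
  rw [Code.eval_curry, hcd]
  simp only [treeProg, Nat.unpair_pair, Encodable.encodek, Option.bind_some, oraclePrefix_eq,
    getElem?_restr]
  split_ifs with h1 h2 h2
  · omega
  · simp only [Option.map_some, Part.coe_some]
    congr 1
    refine treeSeq_congr (fun j => ?_) cd x b k
    congr 1
    rw [restr, ← List.map_take, List.take_range, min_eq_left]
    · rfl
    · rw [List.length_append, List.length_singleton]
      omega
  · simp
  · omega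

/-- The number `g x` stacks the whole tree of test-passing sequences on top of the notation `1`; if
the root already fails, `g x` is `1` itself, which is always a notation. An infinite path would give
an infinite `<_𝒪`-descent from `g x`, and conversely a failure of `g x` to be a notation propagates
from a node to one of its children, tracing an infinite path. -/
theorem exists_reduction_kleeneO {c : α → List Bool → List ℕ → Bool}
    (hc : Primrec fun x : α × List Bool × List ℕ => c x.1 x.2.1 x.2.2) :
    ∃ g : α → ℕ, Primrec g ∧ ∀ (X : Set ℕ) (x : α), g x ∈ kleeneO X ↔
      ¬ ∃ F : ℕ → ℕ, ∀ k, c x (restr (charB X) k) (restr F k) = true := by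
  obtain ⟨cd, hcd⟩ := exists_treeNotation hc
  have hc0 : Primrec fun x : α => c x [] [] :=
    hc.comp (Primrec.id.pair ((Primrec.const []).pair (.const [])))
  refine ⟨fun x => bif c x [] [] then treeNotation cd x [] 1 else 1,
    Primrec.cond hc0 (primrec_treeNotation (.const _) .id (.const _) (.const _)) (.const _),
    fun X x => ?_⟩
  set T : List ℕ → Bool := fun τ => c x (restr (charB X) τ.length) τ with hT
  have hone : 1 ∈ kleeneO X := mem_kleeneO_iff.2 (.inl rfl)
  have hstep : ∀ σ b k, treeSeq T cd x σ b (k + 1) = bif T (σ ++ [k]) then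
      treeNotation cd x (σ ++ [k]) (treeSeq T cd x σ b k) else 2 ^ treeSeq T cd x σ b k :=
    fun _ _ _ => rfl
  have hne : ∀ σ b, treeNotation cd x σ b ∈ kleeneO X →
      ∃ n, KleeneLT X n (treeNotation cd x σ b) := by
    intro σ b h
    refine (mem_kleeneO_iff.1 h).resolve_left fun h1 => ?_
    have : 3 ∣ 1 := h1 ▸ Dvd.intro _ rfl
    omega
  have hfund : ∀ σ b, treeNotation cd x σ b ∈ kleeneO X →
      ∀ k, KleeneLT X (treeSeq T cd x σ b k) (treeNotation cd x σ b) := by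
    intro σ b h k
    obtain ⟨n, hn⟩ := hne σ b h
    obtain ⟨f, hf, hlt, -⟩ := hn.of_lt_lim
    rw [oraclePhi_unique (hcd X x σ b k) (hf k)]
    exact .lt_lim _ f hf hlt k
  -- Along a path, the fundamental sequence of the node `restr F k` contains, as its entry `F k +
  -- 1`, a notation built at the next node of the path; this contradicts accessibility.
  have hdesc : ∀ F : ℕ → ℕ, (∀ k, T (restr F k) = true) → ∀ z, Acc (KleeneLT X) z →
      ∀ k b, z = treeNotation cd x (restr F k) b → z ∉ kleeneO X := by
    intro F hF z hz
    induction hz with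
    | intro z _ ih =>
      rintro k b rfl hn
      have h1 := hfund _ _ hn (F k + 1)
      rw [hstep, ← restr_succ, hF, cond_true] at h1
      exact ih _ h1 (k + 1) _ rfl (mem_kleeneO_iff.2 h1.source)
  -- A node is good when it lies above every base `b` in `𝒪`. All bases are needed because a child
  -- is stacked on whatever its earlier siblings have produced.
  have hgood : ∀ σ, (∀ j, T (σ ++ [j]) = true → ∀ b ∈ kleeneO X,
      KleeneLT X b (treeNotation cd x (σ ++ [j]) b)) → ∀ b ∈ kleeneO X,
      KleeneLT X b (treeNotation cd x σ b) := by
    intro σ h b hb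
    have h2 : ∀ k, treeSeq T cd x σ b k ∈ kleeneO X →
        KleeneLT X (treeSeq T cd x σ b k) (treeSeq T cd x σ b (k + 1)) := by
      intro k hk
      rw [hstep]
      cases hj : T (σ ++ [k])
      · exact lt_two_pow_of_mem_kleeneO hk
      · exact h k hj _ hk
    have h1 : ∀ k, treeSeq T cd x σ b k ∈ kleeneO X := by
      intro k
      induction k with
      | zero => exact hb
      | succ k ih => exact (h2 k ih).mem_right
    exact .lt_lim _ _ (hcd X x σ b) (fun k => h2 k (h1 k)) 0
  constructor
  · rintro h ⟨F, hF⟩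
    have h0 : c x [] [] = true := hF 0
    dsimp only at h
    rw [h0, cond_true] at h
    obtain ⟨n, hn⟩ := hne _ _ h
    exact hdesc F (fun k => by simpa [hT] using hF k) _ hn.acc.2 0 1 rfl h
  · intro hF
    dsimp only
    cases h0 : c x [] []
    · exact hone
    rw [cond_true]
    -- A bad root has a bad child that passes the test, and so on; the chosen children form an
    -- infinite path.
    by_contra hbad
    have hbad' : ¬ ∀ b ∈ kleeneO X, KleeneLT X b (treeNotation cd x [] b) :=
      fun h => hbad (h 1 hone).mem_right
    have hnext : ∀ σ, (¬ ∀ b ∈ kleeneO X, KleeneLT X b (treeNotation cd x σ b)) →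
        ∃ j, T (σ ++ [j]) = true ∧
          ¬ ∀ b ∈ kleeneO X, KleeneLT X b (treeNotation cd x (σ ++ [j]) b) := by
      intro σ h
      by_contra! hcon
      exact h (hgood σ hcon)
    choose! next hnext1 hnext2 using hnext
    let path : ℕ → List ℕ := fun k => Nat.rec [] (fun _ σ => σ ++ [next σ]) k
    have hpath : ∀ k, restr (fun i => next (path i)) k = path k := by
      intro k
      induction k with
      | zero => rfl
      | succ k ih => rw [restr_succ, ih]
    have hbadp : ∀ k, ¬ ∀ b ∈ kleeneO X, KleeneLT X b (treeNotation cd x (path k) b) := by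
      intro k
      induction k with
      | zero => exact hbad'
      | succ k ih => exact hnext2 _ ih
    refine hF ⟨fun i => next (path i), fun k => ?_⟩
    cases k with
    | zero => exact h0
    | succ k =>
      have h1 : T (path (k + 1)) = true := hnext1 _ (hbadp k)
      have h2 : (path (k + 1)).length = k + 1 := by rw [← hpath (k + 1), length_restr]
      rw [hpath]
      simpa only [hT, h2] using h1

theorem Sig.exists_reduction {R : Set ℕ → (ℕ → ℕ) → α → Prop} (h : Sig R) :
    ∃ g : α → ℕ, Primrec g ∧ ∀ (X : Set ℕ) (x : α), g x ∈ kleeneO X ↔ ¬ ∃ G, R X G x := by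
  obtain ⟨c, hc, h⟩ := h.exists_oracle
  obtain ⟨g, hg, h'⟩ := exists_reduction_kleeneO hc
  exact ⟨g, hg, fun X x => (h' X x).trans (not_congr (h X x).symm)⟩

end TreeNotation

/-! ### Search with an oracle -/

namespace Nat.RecursiveIn

variable {O : Set (ℕ →. ℕ)} {f g : ℕ → ℕ}

theorem comp_total (hf : Nat.RecursiveIn O fun n => Part.some (f n))
    (hg : Nat.RecursiveIn O fun n => Part.some (g n)) :
    Nat.RecursiveIn O fun n => Part.some (f (g n)) :=
  (hf.comp hg).of_eq fun n => by simp

theorem pair_total (hf : Nat.RecursiveIn O fun n => Part.some (f n))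
    (hg : Nat.RecursiveIn O fun n => Part.some (g n)) :
    Nat.RecursiveIn O fun n => Part.some (Nat.pair (f n) (g n)) :=
  (hf.pair hg).of_eq fun n => by simp [Seq.seq]

theorem of_primrec (hf : Primrec f) : Nat.RecursiveIn O fun n => Part.some (f n) :=
  (Primrec.nat_iff.1 hf).recursiveIn

end Nat.RecursiveIn

open Classical in
/-- A function whose values can be found by searching for a witness that satisfies a condition
with three oracle queries is computable from the oracle. -/
theorem computableIn_of_search {J : Set ℕ} {g₁ g₂ g₃ : ℕ → ℕ} (h₁ : Primrec g₁) (h₂ : Primrec g₂)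
    (h₃ : Primrec g₃) {i : ℕ → ℕ}
    (hex : ∀ n, ∃ w, g₁ (Nat.pair n w) ∉ J ∧ g₂ (Nat.pair n w) ∈ J ∧ g₃ (Nat.pair n w) ∉ J)
    (hi : ∀ n w, g₁ (Nat.pair n w) ∉ J → g₂ (Nat.pair n w) ∈ J → g₃ (Nat.pair n w) ∉ J →
      w.unpair.2 = i n) :
    ComputableIn {charOracle J} i := by
  have hJ : Nat.RecursiveIn {charOracle J} fun n => Part.some (if n ∈ J then 1 else 0) :=
    .oracle _ rfl
  -- This combination of the three oracle answers vanishes exactly when they are `0, 1, 0`, so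
  -- unbounded search for a zero finds the witness.
  have hp : Primrec fun z : ℕ => z.unpair.1 + (1 - z.unpair.2.unpair.1) + z.unpair.2.unpair.2 := by
    have h0 : Primrec fun z : ℕ => z.unpair.2.unpair :=
      Primrec.unpair.comp (Primrec.snd.comp Primrec.unpair)
    exact Primrec.nat_add.comp (Primrec.nat_add.comp (Primrec.fst.comp Primrec.unpair)
      (Primrec.nat_sub.comp (.const 1) (Primrec.fst.comp h0))) (Primrec.snd.comp h0)
  have ht := (Nat.RecursiveIn.of_primrec hp).comp_total
    ((hJ.comp_total (.of_primrec h₁)).pair_total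
      ((hJ.comp_total (.of_primrec h₂)).pair_total (hJ.comp_total (.of_primrec h₃))))
  refine RecursiveIn.iff_nat.2 ((Nat.RecursiveIn.right.comp ht.rfind).of_eq fun n => ?_)
  have hz : ∀ w, ((if g₁ (Nat.pair n w) ∈ J then 1 else 0) +
      (1 - (if g₂ (Nat.pair n w) ∈ J then 1 else 0)) +
      (if g₃ (Nat.pair n w) ∈ J then 1 else 0) = 0) ↔
      g₁ (Nat.pair n w) ∉ J ∧ g₂ (Nat.pair n w) ∈ J ∧ g₃ (Nat.pair n w) ∉ J := by
    intro w
    split_ifs <;> simp [*]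
  simp only [Nat.unpair_pair]
  obtain ⟨w, hw⟩ := hex n
  obtain ⟨v, hv, -⟩ := Nat.rfind_min' (p := fun w => decide
    ((if g₁ (Nat.pair n w) ∈ J then 1 else 0) + (1 - (if g₂ (Nat.pair n w) ∈ J then 1 else 0)) +
      (if g₃ (Nat.pair n w) ∈ J then 1 else 0) = 0)) (m := w) (by simpa using (hz w).2 hw)
  have hv' := Nat.rfind_spec hv
  simp only [PFun.coe_val, Part.mem_some_iff] at hv'
  obtain ⟨a1, a2, a3⟩ := (hz v).1 (by simpa using hv'.symm)
  have := hi n v a1 a2 a3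
  rw [← this]
  refine Part.eq_some_iff.2 ?_
  refine Part.mem_bind_iff.2 ⟨v, ?_, Part.mem_some _⟩
  exact hv

/-! ### Codes for first-order formulas -/

theorem Nat.unpair_right_lt {p : ℕ} (h : p.unpair.1 ≠ 0) : p.unpair.2 < p := by
  conv_rhs => rw [← Nat.pair_unpair p]
  exact (Nat.right_le_pair 0 _).trans_lt (Nat.pair_lt_pair_left _ (Nat.pos_of_ne_zero h))

/-- The list of the entries of `v` at the positions in the list with code `q`. -/
def lookups {β : Type*} (q : ℕ) (v : List β) : List β :=
  (Denumerable.ofNat (List ℕ) q).filterMap fun i => v[i]?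

/-- Satisfaction of the formula with code `p` in `(D; ∈, X)` under the assignment `v` of values to
the variables; a quantifier binds the variable whose index is the length of `v`. -/
def Sat (D : ZFSet.{u} → Prop) (X : ℕ → List ZFSet.{u} → Prop) (p : ℕ) (v : List ZFSet.{u}) :
    Prop :=
  match _h : p.unpair.1 with
  | 0 => ∃ x y, v[p.unpair.2.unpair.1]? = some x ∧ v[p.unpair.2.unpair.2]? = some y ∧ x ∈ y
  | 1 => ¬ (Sat D X p.unpair.2.unpair.1 v ∧ Sat D X p.unpair.2.unpair.2 v)
  | 2 => ∀ x, D x → Sat D X p.unpair.2 (v ++ [x])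
  | t + 3 => X t (lookups p.unpair.2 v)
termination_by p
decreasing_by
  · exact (Nat.unpair_left_le _).trans_lt (Nat.unpair_right_lt (by omega))
  · exact (Nat.unpair_right_le _).trans_lt (Nat.unpair_right_lt (by omega))
  · exact Nat.unpair_right_lt (by omega)

/-- The code of `x_i ∈ x_j`. -/
def cMem (i j : ℕ) : ℕ := Nat.pair 0 (Nat.pair i j)

/-- The code of `¬ (p ∧ q)`. -/
def cNand (p q : ℕ) : ℕ := Nat.pair 1 (Nat.pair p q)

/-- The code of `∀ x, p`. -/
def cAll (p : ℕ) : ℕ := Nat.pair 2 p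

/-- The code of an atomic formula for the relation variable `t`, where `q` is the code of the list
of the variables. -/
def cRel (t q : ℕ) : ℕ := Nat.pair (t + 3) q

/-- Every natural number is a code: the tag is `0`, `1`, `2` or at least `3`, and subcodes under a
nonzero tag are strictly smaller. -/
theorem code_induction {P : ℕ → Prop} (mem : ∀ i j, P (cMem i j))
    (nand : ∀ p q, P p → P q → P (cNand p q)) (all : ∀ p, P p → P (cAll p))
    (rel : ∀ t q, P (cRel t q)) (p : ℕ) : P p := by
  induction p using Nat.strong_induction_on with
  | _ p ih =>
    have hp := Nat.pair_unpair p
    rcases h : p.unpair.1 with _ | _ | _ | t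
    · rw [h, ← Nat.pair_unpair p.unpair.2] at hp
      exact hp ▸ mem _ _
    · have hlt : p.unpair.2 < p := Nat.unpair_right_lt (by omega)
      rw [h, ← Nat.pair_unpair p.unpair.2] at hp
      exact hp ▸ nand _ _ (ih _ ((Nat.unpair_left_le _).trans_lt hlt))
        (ih _ ((Nat.unpair_right_le _).trans_lt hlt))
    · have hlt : p.unpair.2 < p := Nat.unpair_right_lt (by omega)
      rw [h] at hp
      exact hp ▸ all _ (ih _ hlt)
    · rw [h] at hp
      exact hp ▸ rel _ _

section Sat

variable {D : ZFSet.{u} → Prop} {X : ℕ → List ZFSet.{u} → Prop} {p q : ℕ} {v : List ZFSet.{u}}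

theorem sat_cMem {i j : ℕ} :
    Sat D X (cMem i j) v ↔ ∃ x y, v[i]? = some x ∧ v[j]? = some y ∧ x ∈ y := by
  rw [Sat, cMem]
  split <;> simp_all

theorem sat_cNand : Sat D X (cNand p q) v ↔ ¬ (Sat D X p v ∧ Sat D X q v) := by
  rw [Sat, cNand]
  split <;> simp_all

theorem sat_cAll : Sat D X (cAll p) v ↔ ∀ x, D x → Sat D X p (v ++ [x]) := by
  rw [Sat, cAll]
  split <;> simp_all

theorem sat_cRel {t : ℕ} : Sat D X (cRel t q) v ↔ X t (lookups q v) := by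
  rw [Sat, cRel]
  split <;> simp_all

/-- The code of `p → q`. -/
def cImp (p q : ℕ) : ℕ := cNand p (cNand q q)

theorem sat_cImp : Sat D X (cImp p q) v ↔ (Sat D X p v → Sat D X q v) := by
  simp only [cImp, sat_cNand]
  tauto

/-- The code of `∀ x_N, x_N ∈ x_i ↔ x_N ∈ x_j`. -/
def cEq (N i j : ℕ) : ℕ :=
  cAll (cNand (cImp (cImp (cMem N i) (cMem N j))
    (cNand (cImp (cMem N j) (cMem N i)) (cImp (cMem N j) (cMem N i))))
    (cImp (cImp (cMem N i) (cMem N j))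
    (cNand (cImp (cMem N j) (cMem N i)) (cImp (cMem N j) (cMem N i)))))

/-- Codes have no equality atom. Extensionality replaces it, and quantifying over `D` is enough
because `D` contains all elements of its elements. -/
theorem sat_cEq (hD : ∀ x, D x → ∀ y ∈ x, D y) {i j : ℕ} {x y : ZFSet.{u}} (hx : D x) (hy : D y)
    (hi : v[i]? = some x) (hj : v[j]? = some y) : Sat D X (cEq v.length i j) v ↔ x = y := by
  have hl : ∀ z : ZFSet.{u}, (v ++ [z])[v.length]? = some z := fun z => by simp
  have hv : ∀ {i : ℕ} {x z : ZFSet.{u}}, v[i]? = some x → (v ++ [z])[i]? = some x := by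
    intro i x z h
    rw [List.getElem?_append_left (List.getElem?_eq_some_iff.1 h).1, h]
  simp only [cEq, sat_cAll, sat_cNand, sat_cImp, sat_cMem, hl, hv hi, hv hj, Option.some.injEq,
    exists_and_left, exists_eq_left']
  constructor
  · intro h
    ext z
    have := fun hz => h z hz
    have h1 := hD x hx z
    have h2 := hD y hy z
    tauto
  · rintro rfl z _
    tauto

end Sat

/-! ### Translation of formulas into codes -/

open FirstOrder Language

/-- The interpretation of the relation variables given by `X`. -/
@[reducible] def relStructure (M : ZFSet.{u}) (X : ℕ → List ZFSet.{u} → Prop) : relVarLang.Structure M where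
  funMap f := nomatch f
  RelMap k v := X k (List.ofFn fun i => (v i : ZFSet.{u}))

/-- The length of a list recovers the arity, so a single relation on lists serves the variables with
a given index in all arities at once. -/
theorem exists_relStructure_eq (M : ZFSet.{u}) (S : relVarLang.Structure M) :
    ∃ X, S = relStructure M X := by
  refine ⟨fun k l => ∃ (n : ℕ) (w : Fin n → M),
    (List.ofFn fun i => (w i : ZFSet.{u})) = l ∧ S.RelMap (n := n) k w, ?_⟩
  refine Structure.ext (funext fun n => funext fun f => nomatch f) ?_
  funext n k v
  refine propext ⟨fun h => ⟨n, v, rfl, h⟩, ?_⟩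
  rintro ⟨m, w, hw, h⟩
  obtain rfl : m = n := by simpa using congrArg List.length hw
  obtain rfl : w = v := funext fun i => Subtype.ext (congrFun (List.ofFn_injective hw) i)
  exact h

/-- The index of the variable that a term consists of. -/
def termIndex {V : Type*} {n : ℕ} (idx : V → ℕ) (N : ℕ) :
    (setLang.sum relVarLang).Term (V ⊕ Fin n) → ℕ
  | .var (.inl a) => idx a
  | .var (.inr i) => N + i
  | .func f _ => nomatch f

theorem getElem?_termIndex {V : Type*} {n : ℕ} {idx : V → ℕ} {M : ZFSet.{u}}
    [relVarLang.Structure M] {l : List ZFSet.{u}} {a : V → M} {xs : Fin n → M}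
    (hl : ∀ i, l[idx i]? = some (a i : ZFSet.{u}))
    (t : (setLang.sum relVarLang).Term (V ⊕ Fin n)) :
    (l ++ List.ofFn fun i => (xs i : ZFSet.{u}))[termIndex idx l.length t]? =
      some ((t.realize (Sum.elim a xs) : M) : ZFSet.{u}) := by
  match t with
  | .var (.inl i) =>
    have := hl i
    rw [termIndex, List.getElem?_append_left (List.getElem?_eq_some_iff.1 this).1, this]
    rfl
  | .var (.inr i) => simp [termIndex]
  | .func f _ => nomatch f

theorem lookups_ofFn {β : Type*} {m : ℕ} {g : Fin m → ℕ} {h : Fin m → β} {v : List β}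
    (H : ∀ i, v[g i]? = some (h i)) :
    lookups (Encodable.encode (List.ofFn g)) v = List.ofFn h := by
  rw [lookups, Denumerable.ofNat_encode, List.ofFn_eq_map, List.filterMap_map, List.ofFn_eq_map,
    ← List.filterMap_eq_map]
  congr 1
  funext i
  exact H i

theorem ofFn_snoc_val {M : ZFSet.{u}} {n : ℕ} (xs : Fin n → M) (x : M) :
    (List.ofFn fun i => ((Fin.snoc xs x : Fin (n + 1) → M) i : ZFSet.{u})) =
      (List.ofFn fun i => (xs i : ZFSet.{u})) ++ [(x : ZFSet.{u})] := by
  rw [List.ofFn_succ']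
  simp

/-- Variables become positions in the assignment: the free ones occupy the first `N` places through
`idx`, and the bound variable `i` has position `N + i`, matching the rule that a quantifier appends
its value at the end. -/
theorem exists_code {V : Type*} (idx : V → ℕ) (N : ℕ) {n : ℕ}
    (φ : (setLang.sum relVarLang).BoundedFormula V n) :
    ∃ p, ∀ (M : ZFSet.{u}), (∀ x ∈ M, ∀ y ∈ x, y ∈ M) → ∀ (X : ℕ → List ZFSet.{u} → Prop)
      (l : List ZFSet.{u}) (a : V → M) (xs : Fin n → M), l.length = N →
      (∀ i, l[idx i]? = some (a i : ZFSet.{u})) →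
      letI := relStructure M X
      (φ.Realize a xs ↔ Sat (· ∈ M) X p (l ++ List.ofFn fun i => (xs i : ZFSet.{u}))) := by
  induction φ with
  | @falsum n =>
    -- Position `N + n` is outside the assignment, so this atom is false.
    refine ⟨cMem (N + n) 0, fun M hM X l a xs hN hl => ?_⟩
    simp [sat_cMem, hN, BoundedFormula.Realize]
  | @equal n t₁ t₂ =>
    refine ⟨cEq (N + n) (termIndex idx N t₁) (termIndex idx N t₂),
      fun M hM X l a xs hN hl => ?_⟩
    let _ := relStructure M X
    subst hN
    have hlen : l.length + n = (l ++ List.ofFn fun i => (xs i : ZFSet.{u})).length := by simp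
    rw [hlen, sat_cEq hM (Subtype.prop _) (Subtype.prop _) (getElem?_termIndex hl t₁)
      (getElem?_termIndex hl t₂), Subtype.coe_inj]
    rfl
  | @rel n m R ts =>
    rcases R with R | k
    · cases R
      refine ⟨cMem (termIndex idx N (ts 0)) (termIndex idx N (ts 1)),
        fun M hM X l a xs hN hl => ?_⟩
      let _ := relStructure M X
      subst hN
      rw [sat_cMem, getElem?_termIndex hl, getElem?_termIndex hl]
      simp only [Option.some.injEq, exists_and_left, exists_eq_left']
      rfl
    · change ℕ at k
      refine ⟨cRel k (Encodable.encode (List.ofFn fun i => termIndex idx N (ts i))),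
        fun M hM X l a xs hN hl => ?_⟩
      let _ := relStructure M X
      subst hN
      refine Iff.trans ?_ sat_cRel.symm
      rw [lookups_ofFn fun i => getElem?_termIndex hl (ts i)]
      rfl
  | @imp n φ ψ ih1 ih2 =>
    obtain ⟨p, hp⟩ := ih1
    obtain ⟨q, hq⟩ := ih2
    refine ⟨cImp p q, fun M hM X l a xs hN hl => ?_⟩
    rw [sat_cImp, ← hp M hM X l a xs hN hl, ← hq M hM X l a xs hN hl]
    rfl
  | @all n φ ih =>
    obtain ⟨p, hp⟩ := ih
    refine ⟨cAll p, fun M hM X l a xs hN hl => ?_⟩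
    simp only [sat_cAll, BoundedFormula.Realize, hp M hM X l a _ hN hl, ofFn_snoc_val,
      List.append_assoc, Subtype.forall]

/-- Every code without relation variables is the code of a formula. -/
theorem exists_boundedFormula (p n : ℕ) :
    ∃ φ : setLang.BoundedFormula Empty n, ∀ (M : ZFSet.{u}) (xs : Fin n → M),
      φ.Realize default xs ↔
        Sat (· ∈ M) (fun _ _ => False) p (List.ofFn fun i => (xs i : ZFSet.{u})) := by
  induction p using code_induction generalizing n with
  | mem i j =>
    -- A membership atom with an index out of range is never satisfied and is translated as falsity.
    by_cases h : i < n ∧ j < n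
    · refine ⟨.rel (l := 2) MemSymbol.mem
        ![.var (.inr ⟨i, h.1⟩), .var (.inr ⟨j, h.2⟩)], fun M xs => ?_⟩
      simp only [sat_cMem, List.getElem?_ofFn, h.1, h.2, dif_pos, Option.some.injEq,
        exists_and_left, exists_eq_left']
      rfl
    · refine ⟨.falsum, fun M xs => ?_⟩
      rw [sat_cMem]
      constructor
      · exact False.elim
      · rintro ⟨x, y, hx, hy, -⟩
        have h1 := (List.getElem?_eq_some_iff.1 hx).1
        have h2 := (List.getElem?_eq_some_iff.1 hy).1
        simp only [List.length_ofFn] at h1 h2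
        exact h ⟨h1, h2⟩
  | nand p q ih1 ih2 =>
    obtain ⟨φ, hφ⟩ := ih1 n
    obtain ⟨ψ, hψ⟩ := ih2 n
    exact ⟨(φ ⊓ ψ).not, fun M xs => by simp [sat_cNand, hφ, hψ]⟩
  | all p ih =>
    obtain ⟨φ, hφ⟩ := ih (n + 1)
    refine ⟨φ.all, fun M xs => ?_⟩
    simp only [sat_cAll, BoundedFormula.realize_all, hφ, ofFn_snoc_val, Subtype.forall]
  | rel t q => exact ⟨.falsum, fun M xs => by simp [sat_cRel, BoundedFormula.Realize]⟩

/-! ### Definable subsets through codes, and basic properties of the levels. -/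

/-- A defining formula uses finitely many parameters, which can be listed with the tested element
placed last. In this form definability speaks only of numbers and finite lists and can be
transferred to structures on `ℕ`. -/
theorem mem_definablePowerset {M y : ZFSet.{u}} (hM : ∀ x ∈ M, ∀ y ∈ x, y ∈ M) :
    y ∈ definablePowerset M ↔ ∃ (p : ℕ) (v : List ZFSet.{u}), (∀ z ∈ v, z ∈ M) ∧
      ∀ x, x ∈ y ↔ x ∈ M ∧ Sat (· ∈ M) (fun _ _ => False) p (v ++ [x]) := by
  classical
  rw [definablePowerset, ZFSet.mem_sep, ZFSet.mem_powerset, Set.Definable₁]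
  constructor
  · rintro ⟨hy, h⟩
    obtain ⟨A, -, h⟩ := Set.definable_iff_finitely_definable.1 h
    obtain ⟨φ, hφ⟩ := Set.definable_iff_exists_formula_sum.1 h
    let idx : (A : Set M) ⊕ Fin 1 → ℕ := Sum.elim (fun a => A.toList.idxOf (a : M)) fun _ => A.card
    obtain ⟨p, hp⟩ := exists_code.{u} idx (A.card + 1)
      ((LHom.sumInl : setLang →ᴸ setLang.sum relVarLang).onFormula φ)
    refine ⟨p, A.toList.map Subtype.val, fun z hz => ?_, fun x => ?_⟩
    · obtain ⟨a, -, rfl⟩ := List.mem_map.1 hz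
      exact a.2
    · by_cases hx : x ∈ M
      swap
      · exact ⟨fun h => absurd (hy h) hx, fun h => absurd h.1 hx⟩
      let _ := relStructure M fun _ _ => False
      have h1 := hp M hM (fun _ _ => False) (A.toList.map Subtype.val ++ [x])
        (Sum.elim Subtype.val fun _ => ⟨x, hx⟩) default (by simp) (by
          rintro (⟨a, ha⟩ | i)
          · have h2 : A.toList.idxOf a < A.toList.length :=
              List.idxOf_lt_length_iff.2 (Finset.mem_toList.2 ha)
            rw [List.getElem?_append_left (by simpa [idx] using h2)]
            change (A.toList.map Subtype.val)[A.toList.idxOf a]? = some (a : ZFSet.{u})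
            rw [List.getElem?_map, List.getElem?_eq_getElem h2, List.getElem_idxOf]
            rfl
          · simp [idx])
      rw [List.ofFn_zero, List.append_nil] at h1
      rw [← h1]
      have h3 : (⟨x, hx⟩ : M) ∈ {a : M | (a : ZFSet.{u}) ∈ y} ↔
          φ.Realize (Sum.elim Subtype.val fun _ : Fin 1 => (⟨x, hx⟩ : M)) :=
        Set.ext_iff.1 hφ fun _ => ⟨x, hx⟩
      have h4 := LHom.realize_onFormula (LHom.sumInl : setLang →ᴸ setLang.sum relVarLang) φ
        (v := (Sum.elim Subtype.val fun _ : Fin 1 => (⟨x, hx⟩ : M)))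
      simp only [hx, true_and]
      exact h3.trans h4.symm
  · rintro ⟨p, v, hv, h⟩
    refine ⟨fun x hx => ((h x).1 hx).1, ?_⟩
    lift v to List M using hv
    obtain ⟨φ, hφ⟩ := exists_boundedFormula.{u} p (v.length + 1)
    -- The parameters replace all bound variables but the last, which becomes the free variable, in
    -- agreement with `v ++ [x]`.
    refine Set.definable_iff_exists_formula_sum.2 ⟨φ.toFormula.relabel (Sum.elim Empty.elim
      (Fin.snoc (fun i => Sum.inl ⟨v.get i, Set.mem_univ _⟩) (Sum.inr 0))), ?_⟩
    ext x
    have h1 := hφ M (Fin.snoc v.get (x 0))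
    rw [ofFn_snoc_val] at h1
    have h2 : (List.ofFn fun i => (v.get i : ZFSet.{u})) = v.map Subtype.val :=
      List.ofFn_getElem_eq_map v Subtype.val
    rw [h2] at h1
    have h3 := (h (x 0)).trans ((and_iff_right (x 0).2).trans h1.symm)
    refine h3.trans ?_
    refine Iff.trans ?_ (Formula.realize_relabel.trans
      (BoundedFormula.realize_toFormula φ _)).symm
    refine iff_of_eq ?_
    congr 1
    · exact Subsingleton.elim _ _
    · funext i
      refine Fin.lastCases ?_ (fun i => ?_) i <;> simp

theorem mem_constructibleLevel {α : Ordinal.{u}} {x : ZFSet.{u}} :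
    x ∈ constructibleLevel α ↔ ∃ β < α, x ∈ definablePowerset (constructibleLevel β) := by
  rw [constructibleLevel, ZFSet.mem_iUnion]
  simp

theorem mem_of_mem_definablePowerset {M x y : ZFSet.{u}} (h : x ∈ definablePowerset M)
    (hy : y ∈ x) : y ∈ M := by
  rw [definablePowerset, ZFSet.mem_sep, ZFSet.mem_powerset] at h
  exact h.1 hy

theorem constructibleLevel_mono {α β : Ordinal.{u}} (h : α ≤ β) {x : ZFSet.{u}}
    (hx : x ∈ constructibleLevel α) : x ∈ constructibleLevel β := by
  obtain ⟨γ, hγ, hx⟩ := mem_constructibleLevel.1 hx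
  exact mem_constructibleLevel.2 ⟨γ, hγ.trans_le h, hx⟩

theorem constructibleLevel_transitive {α : Ordinal.{u}} :
    ∀ x ∈ constructibleLevel α, ∀ y ∈ x, y ∈ constructibleLevel α := by
  intro x hx y hy
  obtain ⟨β, hβ, hx⟩ := mem_constructibleLevel.1 hx
  exact constructibleLevel_mono hβ.le (mem_of_mem_definablePowerset hx hy)

theorem constructibleLevel_mem {α β : Ordinal.{u}} (h : α < β) :
    constructibleLevel α ∈ constructibleLevel β := by
  -- With the assignment `[x]`, position `1` is empty; the atom is false and its NAND is true
  -- everywhere, which defines the whole level.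
  refine mem_constructibleLevel.2 ⟨α, h, (mem_definablePowerset constructibleLevel_transitive).2
    ⟨cNand (cMem 1 0) (cMem 1 0), [], by simp, fun x => ?_⟩⟩
  simp [sat_cNand, sat_cMem]

theorem constructibleLevel_injective : Function.Injective constructibleLevel.{u} := by
  intro α β h
  rcases lt_trichotomy α β with hlt | rfl | hlt
  · exact absurd (h ▸ constructibleLevel_mem hlt) (ZFSet.mem_irrefl _)
  · rfl
  · exact absurd (h ▸ constructibleLevel_mem hlt) (ZFSet.mem_irrefl _)

/-! ### Copies of levels of the constructible hierarchy with domain `ℕ` -/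

/-- `x` belongs to the `b`-th level of a structure with rank function `ρ`: the level `0` is the
whole structure, and the level `c + 1` consists of the elements of rank less than `c`. -/
def InLevel (r : ℕ → ℕ → Prop) (ρ : ℕ → ℕ) (b x : ℕ) : Prop :=
  b = 0 ∨ ∃ c, b = c + 1 ∧ r (ρ x) c

/-- `(ℕ; E)` is a constructible hierarchy along `r`, with rank function `ρ`, relations `Y` for the
relation variables, and satisfaction relations `S` of its levels. -/
structure IsHierarchy (r E : ℕ → ℕ → Prop) (ρ : ℕ → ℕ) (S : ℕ → ℕ → List ℕ → Prop)
    (Y : ℕ → List ℕ → Prop) : Prop where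
  mem : ∀ b i j v, S b (cMem i j) v ↔ ∃ x y, v[i]? = some x ∧ v[j]? = some y ∧ E x y
  nand : ∀ b p q v, S b (cNand p q) v ↔ ¬ (S b p v ∧ S b q v)
  all : ∀ b p v, S b (cAll p) v ↔ ∀ x, InLevel r ρ b x → S b p (v ++ [x])
  rel : ∀ b t q v, S b (cRel t q) v ↔ b = 0 ∧ Y t (lookups q v)
  ext : ∀ x y, (∀ z, E z x ↔ E z y) → x = y
  definable : ∀ x, ∃ p v, (∀ z ∈ v, r (ρ z) (ρ x)) ∧
    ∀ y, E y x ↔ r (ρ y) (ρ x) ∧ S (ρ x + 1) p (v ++ [y])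
  comprehension : ∀ c p v, (∀ z ∈ v, r (ρ z) c) → ∃ x, (ρ x = c ∨ r (ρ x) c) ∧
    ∀ y, E y x ↔ r (ρ y) c ∧ S (c + 1) p (v ++ [y])

theorem lookups_map {β γ : Type*} (f : β → γ) (q : ℕ) (v : List β) :
    lookups q (v.map f) = (lookups q v).map f := by
  simp only [lookups, List.getElem?_map, List.map_filterMap]

/-! ### The Mostowski collapse of a hierarchy coded on `ℕ`. -/

section Collapse

variable {r E : ℕ → ℕ → Prop} {ρ : ℕ → ℕ} {S : ℕ → ℕ → List ℕ → Prop} {Y : ℕ → List ℕ → Prop}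

/-- The Mostowski collapse. -/
noncomputable def collapse (hr : WellFounded r) (E : ℕ → ℕ → Prop) (ρ : ℕ → ℕ) : ℕ → ZFSet.{u} :=
  (InvImage.wf ρ hr).fix fun x ih =>
    ZFSet.range fun y : {y // E y x ∧ r (ρ y) (ρ x)} => ih y y.2.2

/-- The rank condition in the recursion costs nothing, since by `definable` the members of `x` have
smaller rank. -/
theorem mem_collapse (hr : WellFounded r) (h : IsHierarchy r E ρ S Y) {x : ℕ} {z : ZFSet.{u}} :
    z ∈ collapse hr E ρ x ↔ ∃ y, E y x ∧ collapse hr E ρ y = z := by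
  rw [collapse, WellFounded.fix_eq, ZFSet.mem_range]
  constructor
  · rintro ⟨y, rfl⟩
    exact ⟨y, y.2.1, rfl⟩
  · rintro ⟨y, hy, rfl⟩
    obtain ⟨p, v, -, hx⟩ := h.definable x
    exact ⟨⟨y, hy, ((hx y).1 hy).1⟩, rfl⟩

theorem collapse_injective (hr : WellFounded r) (h : IsHierarchy r E ρ S Y) :
    Function.Injective (collapse.{u} hr E ρ) := by
  have hlt : ∀ {x y}, E y x → r (ρ y) (ρ x) := fun {x y} hy => by
    obtain ⟨p, v, -, hx⟩ := h.definable x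
    exact ((hx y).1 hy).1
  intro x
  induction x using (InvImage.wf ρ hr).induction with
  | _ x ih =>
    intro x' hxx
    refine h.ext x x' fun z => ⟨fun hz => ?_, fun hz => ?_⟩
    · obtain ⟨z', hz', he⟩ := (mem_collapse hr h).1 (hxx ▸ (mem_collapse hr h).2 ⟨z, hz, rfl⟩)
      rwa [ih z (hlt hz) he.symm]
    · obtain ⟨z', hz', he⟩ := (mem_collapse hr h).1 (hxx ▸ (mem_collapse hr h).2 ⟨z, hz, rfl⟩)
      rwa [← ih z' (hlt hz') he]

/-- The Tarski clauses determine `S`, so by induction on codes it is true satisfaction in the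
collapsed level. Injectivity of the collapse is what carries atoms back. -/
theorem IsHierarchy.sat_iff (hr : WellFounded r) (h : IsHierarchy r E ρ S Y) (b p : ℕ)
    (v : List ℕ) :
    S b p v ↔ Sat (fun z => ∃ x, InLevel r ρ b x ∧ collapse.{u} hr E ρ x = z)
      (fun t l => b = 0 ∧ ∃ w, Y t w ∧ w.map (collapse hr E ρ) = l) p
      (v.map (collapse hr E ρ)) := by
  have hinj := collapse_injective.{u} hr h
  induction p using code_induction generalizing v with
  | mem i j =>
    rw [h.mem, sat_cMem]
    simp only [List.getElem?_map, Option.map_eq_some_iff]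
    constructor
    · rintro ⟨x, y, hx, hy, hxy⟩
      exact ⟨_, _, ⟨x, hx, rfl⟩, ⟨y, hy, rfl⟩, (mem_collapse hr h).2 ⟨x, hxy, rfl⟩⟩
    · rintro ⟨_, _, ⟨x, hx, rfl⟩, ⟨y, hy, rfl⟩, hxy⟩
      obtain ⟨x', hx', he⟩ := (mem_collapse hr h).1 hxy
      exact ⟨x, y, hx, hy, hinj he ▸ hx'⟩
  | nand p q ih1 ih2 =>
    rw [h.nand, sat_cNand]
    exact not_congr (and_congr (ih1 v) (ih2 v))
  | all p ih =>
    rw [h.all, sat_cAll]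
    simp only [ih, List.map_append, List.map_cons, List.map_nil]
    constructor
    · rintro hx _ ⟨x, hb, rfl⟩
      exact hx x hb
    · exact fun hx x hb => hx _ ⟨x, hb, rfl⟩
  | rel t q =>
    rw [h.rel, sat_cRel, lookups_map]
    refine and_congr_right fun _ => ⟨fun hy => ⟨_, hy, rfl⟩, ?_⟩
    rintro ⟨w, hw, he⟩
    rwa [← (List.map_injective_iff.2 hinj) he]

variable {α : Ordinal.{u}} (o : r ≃r fun a b : Set.Iio α => a < b)

include o in
theorem wellFounded_of_copy : WellFounded r :=
  o.toRelEmbedding.wellFounded wellFounded_lt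

/-- One step of the hierarchy: `definable` shows that no element of rank `c` is superfluous, and
`comprehension` that no definable subset is missing. The latter may already have appeared at a
smaller rank. -/
theorem collapse_mem_definablePowerset (hr : WellFounded r) (h : IsHierarchy r E ρ S Y) {c : ℕ}
    {M : ZFSet.{u}} (hM : ∀ x ∈ M, ∀ y ∈ x, y ∈ M)
    (hc : ∀ z, (∃ x, r (ρ x) c ∧ collapse hr E ρ x = z) ↔ z ∈ M) :
    (∀ x, ρ x = c → collapse hr E ρ x ∈ definablePowerset M) ∧
      ∀ z ∈ definablePowerset M, ∃ x, (ρ x = c ∨ r (ρ x) c) ∧ collapse hr E ρ x = z := by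
  have hsat : ∀ p v, S (c + 1) p v ↔ Sat (· ∈ M) (fun _ _ => False) p
      (v.map (collapse hr E ρ)) := by
    intro p v
    rw [h.sat_iff hr (c + 1) p v]
    have h1 : (fun z => ∃ x, InLevel r ρ (c + 1) x ∧ collapse hr E ρ x = z) = (· ∈ M) := by
      funext z
      rw [← hc z]
      simp [InLevel]
    rw [h1]
    simp
  constructor
  · rintro x rfl
    obtain ⟨p, v, hv, hx⟩ := h.definable x
    refine (mem_definablePowerset hM).2 ⟨p, v.map (collapse hr E ρ), fun z hz => ?_, fun z => ?_⟩
    · obtain ⟨y, hy, rfl⟩ := List.mem_map.1 hz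
      exact (hc _).1 ⟨y, hv y hy, rfl⟩
    · rw [mem_collapse hr h]
      constructor
      · rintro ⟨y, hy, rfl⟩
        obtain ⟨h1, h2⟩ := (hx y).1 hy
        exact ⟨(hc _).1 ⟨y, h1, rfl⟩, by simpa using (hsat _ _).1 h2⟩
      · rintro ⟨h1, h2⟩
        obtain ⟨y, hy, rfl⟩ := (hc _).2 h1
        exact ⟨y, (hx y).2 ⟨hy, (hsat _ _).2 (by simpa using h2)⟩, rfl⟩
  · intro z hz
    obtain ⟨p, v, hv, hz⟩ := (mem_definablePowerset hM).1 hz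
    have hv' : ∀ z ∈ v, ∃ x, r (ρ x) c ∧ collapse hr E ρ x = z := fun z hz => (hc z).2 (hv z hz)
    choose! g hg1 hg2 using hv'
    have hgv : (v.map g).map (collapse hr E ρ) = v := by
      rw [List.map_map]
      exact (List.map_congr_left (g := id) hg2).trans (List.map_id v)
    obtain ⟨x, hx1, hx2⟩ := h.comprehension c p (v.map g) (by simpa using hg1)
    refine ⟨x, hx1, ?_⟩
    ext y
    rw [mem_collapse hr h, hz]
    constructor
    · rintro ⟨y, hy, rfl⟩
      obtain ⟨h1, h2⟩ := (hx2 y).1 hy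
      rw [hsat, List.map_append, hgv] at h2
      exact ⟨(hc _).1 ⟨y, h1, rfl⟩, h2⟩
    · rintro ⟨h1, h2⟩
      obtain ⟨y, hy, rfl⟩ := (hc _).2 h1
      refine ⟨y, (hx2 y).2 ⟨hy, ?_⟩, rfl⟩
      rw [hsat, List.map_append, hgv]
      exact h2

theorem mem_constructibleLevel_copy {β : Ordinal.{u}} {P : ℕ → Prop}
    (hP : ∀ δ : Set.Iio α, (δ : Ordinal.{u}) < β ↔ P (o.symm δ)) (hβ : β ≤ α) {z : ZFSet.{u}} :
    z ∈ constructibleLevel β ↔ ∃ c, P c ∧ z ∈ definablePowerset (constructibleLevel (o c)) := by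
  rw [mem_constructibleLevel]
  constructor
  · rintro ⟨δ, hδ, hz⟩
    refine ⟨o.symm ⟨δ, hδ.trans_le hβ⟩, (hP _).1 hδ, by simpa using hz⟩
  · rintro ⟨c, hc, hz⟩
    exact ⟨o c, (hP _).2 (by simpa using hc), hz⟩

theorem mem_constructibleLevel_iff {c : ℕ} {z : ZFSet.{u}} :
    z ∈ constructibleLevel (o c) ↔
      ∃ d, r d c ∧ z ∈ definablePowerset (constructibleLevel (o d)) :=
  mem_constructibleLevel_copy o (fun δ => by
    rw [← o.map_rel_iff, RelIso.apply_symm_apply]; rfl) (o c).2.le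

theorem mem_constructibleLevel_top_iff {z : ZFSet.{u}} :
    z ∈ constructibleLevel α ↔ ∃ d, z ∈ definablePowerset (constructibleLevel (o d)) := by
  rw [mem_constructibleLevel_copy o (P := fun _ => True) (fun δ => ⟨fun _ => trivial, fun _ => δ.2⟩) le_rfl]
  simp

/-- Induction along `r`, applying the one-step lemma at each `d` below `c`; transitivity of `r`
handles sets that appear before rank `d`. -/
theorem collapse_image (hr : WellFounded r) (h : IsHierarchy r E ρ S Y) (c : ℕ) :
    ∀ z, (∃ x, r (ρ x) c ∧ collapse hr E ρ x = z) ↔ z ∈ constructibleLevel (o c) := by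
  have htr : ∀ {a b c}, r a b → r b c → r a c := fun {a b c} h1 h2 =>
    o.map_rel_iff.1 ((o.map_rel_iff.2 h1).trans (o.map_rel_iff.2 h2))
  induction c using hr.induction with
  | _ c ih =>
    intro z
    rw [mem_constructibleLevel_iff o]
    constructor
    · rintro ⟨x, hx, rfl⟩
      exact ⟨ρ x, hx, (collapse_mem_definablePowerset hr h constructibleLevel_transitive
        (ih _ hx)).1 x rfl⟩
    · rintro ⟨d, hd, hz⟩
      obtain ⟨x, hx, rfl⟩ := (collapse_mem_definablePowerset hr h constructibleLevel_transitive
        (ih _ hd)).2 z hz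
      refine ⟨x, ?_, rfl⟩
      rcases hx with rfl | hx
      · exact hd
      · exact htr hx hd

include o in
theorem collapse_range (hr : WellFounded r) (h : IsHierarchy r E ρ S Y) (z : ZFSet.{u}) :
    (∃ x, collapse hr E ρ x = z) ↔ z ∈ constructibleLevel α := by
  rw [mem_constructibleLevel_top_iff o]
  constructor
  · rintro ⟨x, rfl⟩
    exact ⟨ρ x, (collapse_mem_definablePowerset hr h constructibleLevel_transitive
      (collapse_image o hr h _)).1 x rfl⟩
  · rintro ⟨d, hz⟩
    obtain ⟨x, -, hx⟩ := (collapse_mem_definablePowerset hr h constructibleLevel_transitive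
      (collapse_image o hr h d)).2 z hz
    exact ⟨x, hx⟩

/-- The element `w` collapses to `L_β` for the `β` represented by `n`, and `S` at index `0` is truth
in `L_α`. Well-foundedness comes from the copy, so the hierarchy need not assert it. -/
theorem IsHierarchy.exists_sat (h : IsHierarchy r E ρ S Y) {n p w : ℕ}
    (hw : ∀ y, E y w ↔ r (ρ y) n) (hS : S 0 p [w]) :
    ∃ X, Sat (· ∈ constructibleLevel α) X p [constructibleLevel (o n)] := by
  have hr := wellFounded_of_copy o
  have h1 : (fun z => ∃ x, InLevel r ρ 0 x ∧ collapse.{u} hr E ρ x = z) =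
      (· ∈ constructibleLevel α) := by
    funext z
    rw [← collapse_range o hr h z]
    simp [InLevel]
  have h2 : collapse hr E ρ w = constructibleLevel (o n) := by
    ext z
    rw [mem_collapse hr h, ← collapse_image o hr h]
    simp only [hw]
  rw [h.sat_iff hr, h1, List.map_singleton, h2] at hS
  exact ⟨_, hS⟩

end Collapse

/-! ### Existence of a hierarchy on `ℕ` along a copy. -/

section Copy

variable {α : Ordinal.{u}} {r : ℕ → ℕ → Prop} (o : r ≃r fun a b : Set.Iio α => a < b)

theorem countable_definablePowerset {M : ZFSet.{u}} (hM : ∀ x ∈ M, ∀ y ∈ x, y ∈ M)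
    (hc : {x | x ∈ M}.Countable) : {x | x ∈ definablePowerset M}.Countable := by
  have : Countable M := hc
  refine (Set.countable_range fun q : ℕ × List M => M.sep fun x =>
    Sat (· ∈ M) (fun _ _ => False) q.1 (q.2.map Subtype.val ++ [x])).mono fun y hy => ?_
  obtain ⟨p, v, hv, h⟩ := (mem_definablePowerset hM).1 hy
  lift v to List M using hv
  exact ⟨(p, v), ZFSet.ext fun x => ZFSet.mem_sep.trans (h x).symm⟩

include o in
theorem countable_constructibleLevel : {x | x ∈ constructibleLevel α}.Countable := by
  have hr := wellFounded_of_copy o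
  have h : ∀ c, {x | x ∈ constructibleLevel (o c : Ordinal.{u})}.Countable := by
    intro c
    induction c using hr.induction with
    | _ c ih =>
      refine (Set.countable_iUnion fun d : {d // r d c} =>
        countable_definablePowerset constructibleLevel_transitive (ih d d.2)).mono fun x hx => ?_
      obtain ⟨d, hd, hx⟩ := (mem_constructibleLevel_iff o).1 hx
      exact Set.mem_iUnion.2 ⟨⟨d, hd⟩, hx⟩
  refine (Set.countable_iUnion fun d =>
    countable_definablePowerset constructibleLevel_transitive (h d)).mono fun x hx => ?_
  exact Set.mem_iUnion.2 ((mem_constructibleLevel_top_iff o).1 hx)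

include o in
-- Definable subsets of a countable set are countable in number, and the levels below `α` are
-- infinitely many distinct elements.
theorem exists_equiv_constructibleLevel : Nonempty (ℕ ≃ constructibleLevel α) := by
  have : Countable (constructibleLevel α) := countable_constructibleLevel o
  have : Infinite (constructibleLevel α) :=
    Infinite.of_injective (fun n => ⟨_, constructibleLevel_mem (o n).2⟩) fun a b h =>
      o.injective (Subtype.ext (constructibleLevel_injective (congrArg Subtype.val h)))
  exact nonempty_equiv_of_countable

/-- The true `L_α` is transported along a bijection with `ℕ`; the rank of an element is the
`r`-least index of a level over which it is definable, and `S` is true satisfaction. -/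
theorem exists_isHierarchy {p n : ℕ} {X : ℕ → List ZFSet.{u} → Prop}
    (h : Sat (· ∈ constructibleLevel α) X p [constructibleLevel (o n)]) :
    ∃ E ρ S Y w, IsHierarchy r E ρ S Y ∧ (∀ y, E y w ↔ r (ρ y) n) ∧ S 0 p [w] := by
  have hr := wellFounded_of_copy o
  have htr : ∀ {a b c}, r a b → r b c → r a c := fun {a b c} h1 h2 =>
    o.map_rel_iff.1 ((o.map_rel_iff.2 h1).trans (o.map_rel_iff.2 h2))
  have htri : ∀ a b, ¬ r a b → b = a ∨ r b a := fun a b h => by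
    rcases lt_trichotomy (o a) (o b) with h1 | h1 | h1
    · exact absurd (o.map_rel_iff.1 h1) h
    · exact .inl (o.injective h1.symm)
    · exact .inr (o.map_rel_iff.1 h1)
  obtain ⟨e⟩ := exists_equiv_constructibleLevel o
  have hne : ∀ x, {c | (e x : ZFSet.{u}) ∈ definablePowerset (constructibleLevel (o c))}.Nonempty :=
    fun x => (mem_constructibleLevel_top_iff o).1 (e x).2
  let ρ : ℕ → ℕ := fun x => hr.min _ (hne x)
  have hρ : ∀ x, (e x : ZFSet.{u}) ∈ definablePowerset (constructibleLevel (o (ρ x))) :=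
    fun x => hr.min_mem _ (hne x)
  have hmin : ∀ x c, (e x : ZFSet.{u}) ∈ definablePowerset (constructibleLevel (o c)) →
      ρ x = c ∨ r (ρ x) c := fun x c hc => htri _ _ (hr.not_lt_min _ hc)
  have hlev : ∀ x c, r (ρ x) c ↔ (e x : ZFSet.{u}) ∈ constructibleLevel (o c) := by
    intro x c
    rw [mem_constructibleLevel_iff o]
    constructor
    · exact fun h => ⟨_, h, hρ x⟩
    · rintro ⟨d, hd, hx⟩
      rcases hmin x d hx with h | h
      · rwa [h]
      · exact htr h hd
  have hsurj : ∀ {z}, z ∈ constructibleLevel α → ∃ x, (e x : ZFSet.{u}) = z := fun {z} hz =>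
    ⟨e.symm ⟨z, hz⟩, by simp⟩
  have hlevel : ∀ b z, (∃ x, InLevel r ρ b x ∧ (e x : ZFSet.{u}) = z) ↔
      if b = 0 then z ∈ constructibleLevel α else z ∈ constructibleLevel (o (b - 1)) := by
    intro b z
    cases b with
    | zero =>
      simp only [InLevel, true_or, true_and, if_true]
      exact ⟨fun ⟨x, hx⟩ => hx ▸ (e x).2, hsurj⟩
    | succ c =>
      simp only [InLevel, Nat.succ_ne_zero, false_or, if_false, Nat.add_sub_cancel]
      constructor
      · rintro ⟨x, ⟨d, hd, hx⟩, rfl⟩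
        obtain rfl : c = d := by omega
        exact (hlev x c).1 hx
      · intro hz
        obtain ⟨x, rfl⟩ := hsurj (constructibleLevel_mono (o c).2.le hz)
        exact ⟨x, ⟨c, rfl, (hlev x c).2 hz⟩, rfl⟩
  let f : ℕ → ZFSet.{u} := fun x => e x
  let S : ℕ → ℕ → List ℕ → Prop := fun b p v =>
    Sat (fun z => ∃ x, InLevel r ρ b x ∧ f x = z) (fun t l => b = 0 ∧ X t l) p (v.map f)
  have hS : ∀ c p v, S (c + 1) p v ↔ Sat (· ∈ constructibleLevel (o c)) (fun _ _ => False) p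
      (v.map f) := by
    intro c p v
    have h1 : (fun z => ∃ x, InLevel r ρ (c + 1) x ∧ f x = z) =
        (· ∈ constructibleLevel (o c)) := by
      funext z
      simpa using hlevel (c + 1) z
    simp only [S, h1]
    simp
  obtain ⟨w, hw⟩ := hsurj (constructibleLevel_mem (o n).2)
  refine ⟨fun x y => f x ∈ f y, ρ, S, fun t v => X t (v.map f), w, ?_, fun y => ?_, ?_⟩
  · constructor
    · intro b i j v
      simp only [S, sat_cMem, List.getElem?_map, Option.map_eq_some_iff]
      constructor
      · rintro ⟨_, _, ⟨x, hx, rfl⟩, ⟨y, hy, rfl⟩, hxy⟩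
        exact ⟨x, y, hx, hy, hxy⟩
      · rintro ⟨x, y, hx, hy, hxy⟩
        exact ⟨_, _, ⟨x, hx, rfl⟩, ⟨y, hy, rfl⟩, hxy⟩
    · intro b p q v
      exact sat_cNand
    · intro b p v
      simp only [S, sat_cAll, List.map_append, List.map_cons, List.map_nil]
      constructor
      · exact fun hx x hb => hx _ ⟨x, hb, rfl⟩
      · rintro hx _ ⟨x, hb, rfl⟩
        exact hx x hb
    · intro b t q v
      simp only [S, sat_cRel, lookups_map]
    · intro x y hxy
      refine e.injective (Subtype.ext (ZFSet.ext fun z => ⟨fun hz => ?_, fun hz => ?_⟩))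
      · obtain ⟨z, rfl⟩ := hsurj (constructibleLevel_transitive _ (e x).2 z hz)
        exact (hxy z).1 hz
      · obtain ⟨z, rfl⟩ := hsurj (constructibleLevel_transitive _ (e y).2 z hz)
        exact (hxy z).2 hz
    · intro x
      obtain ⟨p, v, hv, hx⟩ := (mem_definablePowerset constructibleLevel_transitive).1 (hρ x)
      have hv' : ∀ z ∈ v, ∃ x, f x = z := fun z hz =>
        hsurj (constructibleLevel_mono (o (ρ x)).2.le (hv z hz))
      obtain ⟨v, rfl⟩ : ∃ v' : List ℕ, v'.map f = v := by
        choose! g hg using hv'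
        refine ⟨v.map g, ?_⟩
        rw [List.map_map]
        exact (List.map_congr_left (g := id) hg).trans (List.map_id v)
      refine ⟨p, v, fun z hz => (hlev z _).2 (hv _ (List.mem_map_of_mem hz)), fun y => ?_⟩
      rw [hS, hlev]
      simpa using hx (f y)
    · intro c p v hv
      let z := (constructibleLevel (o c)).sep fun x =>
        Sat (· ∈ constructibleLevel (o c)) (fun _ _ => False) p (v.map f ++ [x])
      have hz : z ∈ definablePowerset (constructibleLevel (o c)) := by
        refine (mem_definablePowerset constructibleLevel_transitive).2
          ⟨p, v.map f, fun z hz => ?_, fun x => ZFSet.mem_sep⟩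
        obtain ⟨y, hy, rfl⟩ := List.mem_map.1 hz
        exact (hlev _ _).1 (hv y hy)
      obtain ⟨x, hx⟩ := hsurj ((mem_constructibleLevel_top_iff o).2 ⟨c, hz⟩)
      refine ⟨x, hmin x c (hx ▸ hz), fun y => ?_⟩
      rw [hS, hlev]
      simp only [f, hx, z, ZFSet.mem_sep, List.map_append, List.map_cons, List.map_nil]
  · simp only [f, hw, hlev]
  · have h1 : (fun z => ∃ x, InLevel r ρ 0 x ∧ f x = z) = (· ∈ constructibleLevel α) := by
      funext z
      simpa using hlevel 0 z
    simp only [S, h1, true_and]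
    simpa [f, hw] using h

theorem exists_isHierarchy_iff {p n : ℕ} :
    (∃ E ρ S Y w, IsHierarchy r E ρ S Y ∧ (∀ y, E y w ↔ r (ρ y) n) ∧ S 0 p [w]) ↔
      ∃ X, Sat (· ∈ constructibleLevel α) X p [constructibleLevel (o n)] :=
  ⟨fun ⟨_, _, _, _, _, h, hw, hS⟩ => h.exists_sat o hw hS, fun ⟨_, h⟩ => exists_isHierarchy o h⟩

end Copy

/-! ### The existence of a hierarchy is `Σ¹₁` -/

section Coding

/-- The order with atomic diagram `A`. -/
def ordOf (A : Set ℕ) (a b : ℕ) : Prop := Nat.pair a b ∈ A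

/-- The membership relation coded by `G`. -/
def memOf (G : ℕ → ℕ) (x y : ℕ) : Prop := G (Nat.pair 0 (Nat.pair x y)) = 0

/-- The rank function coded by `G`. -/
def rankOf (G : ℕ → ℕ) (x : ℕ) : ℕ := G (Nat.pair 1 x)

/-- The satisfaction relations coded by `G`. -/
def satOf (G : ℕ → ℕ) (b p : ℕ) (v : List ℕ) : Prop :=
  G (Nat.pair 2 (Encodable.encode (b, p, v))) = 0

/-- The values of the relation variables coded by `G`. -/
def relOf (G : ℕ → ℕ) (t : ℕ) (v : List ℕ) : Prop :=
  G (Nat.pair 3 (Encodable.encode (t, v))) = 0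

/-- The four ingredients are placed in disjoint columns of one function, a relation being true where
the value is `0`. -/
theorem exists_coding (E : ℕ → ℕ → Prop) (ρ : ℕ → ℕ) (S : ℕ → ℕ → List ℕ → Prop)
    (Y : ℕ → List ℕ → Prop) :
    ∃ G, memOf G = E ∧ rankOf G = ρ ∧ satOf G = S ∧ relOf G = Y := by
  classical
  let G : ℕ → ℕ := fun m =>
    match m.unpair.1 with
    | 0 => if E m.unpair.2.unpair.1 m.unpair.2.unpair.2 then 0 else 1
    | 1 => ρ m.unpair.2
    | 2 => if ∃ q ∈ Encodable.decode (α := ℕ × ℕ × List ℕ) m.unpair.2, S q.1 q.2.1 q.2.2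
      then 0 else 1
    | _ => if ∃ q ∈ Encodable.decode (α := ℕ × List ℕ) m.unpair.2, Y q.1 q.2 then 0 else 1
  refine ⟨G, ?_, ?_, ?_, ?_⟩
  · funext x y
    simp [memOf, G]
  · funext x
    simp [rankOf, G]
  · funext b p v
    simp only [satOf, G, Nat.unpair_pair, Encodable.encodek, Option.mem_some_iff, exists_eq_left']
    simp
  · funext t v
    simp only [relOf, G, Nat.unpair_pair, Encodable.encodek, Option.mem_some_iff, exists_eq_left']
    simp

variable {α : Type*} [Primcodable α]

namespace Arith

theorem ord {f g : α → ℕ} (hf : Primrec f) (hg : Primrec g) :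
    Arith fun A _ a => ordOf A (f a) (g a) :=
  oracle_mem (Primrec₂.natPair.comp hf hg)

theorem memOf {f g : α → ℕ} (hf : Primrec f) (hg : Primrec g) :
    Arith fun _ G a => memOf G (f a) (g a) :=
  oracle_eq (Primrec₂.natPair.comp (.const 0) (Primrec₂.natPair.comp hf hg)) (.const 0)

theorem rankOf_eq {f g : α → ℕ} (hf : Primrec f) (hg : Primrec g) :
    Arith fun _ G a => rankOf G (f a) = g a :=
  oracle_eq (Primrec₂.natPair.comp (.const 1) hf) hg

/-- The query to `A` contains a value of `G`; an existential quantifier naming that value removes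
the nesting. -/
theorem rankOf_ord {f g : α → ℕ} (hf : Primrec f) (hg : Primrec g) :
    Arith fun A G a => ordOf A (rankOf G (f a)) (g a) :=
  (Arith.ex (R := fun A G a c => rankOf G (f a) = c ∧ ordOf A c (g a))
    ((rankOf_eq (hf.comp .fst) .snd).and (ord .snd (hg.comp .fst)))).of_iff fun _ _ _ => by simp

theorem satOf {b p : α → ℕ} {v : α → List ℕ} (hb : Primrec b) (hp : Primrec p) (hv : Primrec v) :
    Arith fun _ G a => satOf G (b a) (p a) (v a) :=
  oracle_eq (Primrec₂.natPair.comp (.const 2) (Primrec.encode.comp (hb.pair (hp.pair hv))))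
    (.const 0)

theorem relOf {t : α → ℕ} {v : α → List ℕ} (ht : Primrec t) (hv : Primrec v) :
    Arith fun _ G a => relOf G (t a) (v a) :=
  oracle_eq (Primrec₂.natPair.comp (.const 3) (Primrec.encode.comp (ht.pair hv))) (.const 0)

theorem list_mem {f : α → ℕ} {v : α → List ℕ} (hf : Primrec f) (hv : Primrec v) :
    Arith fun _ _ a => f a ∈ v a :=
  (Arith.ex (R := fun _ _ a i => (v a)[i]? = some (f a))
    (Arith.eq (Primrec.list_getElem?.comp (hv.comp .fst) .snd)
      (Primrec.option_some.comp (hf.comp .fst)))).of_iff fun _ _ _ => List.mem_iff_getElem?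

theorem inLevel {b x : α → ℕ} (hb : Primrec b) (hx : Primrec x) :
    Arith fun A G a => InLevel (ordOf A) (_root_.rankOf G) (b a) (x a) :=
  (Arith.eq hb (.const 0)).or (Arith.ex ((Arith.eq (hb.comp .fst) (Primrec.succ.comp .snd)).and
    (rankOf_ord (hx.comp .fst) .snd)))

end Arith

theorem primrec_lookups {q : α → ℕ} {v : α → List ℕ} (hq : Primrec q) (hv : Primrec v) :
    Primrec fun a => lookups (q a) (v a) :=
  Primrec.listFilterMap ((Primrec.ofNat (List ℕ)).comp hq)
    (Primrec.list_getElem?.comp (hv.comp .fst) .snd)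

theorem primrec_cNand {p q : α → ℕ} (hp : Primrec p) (hq : Primrec q) :
    Primrec fun a => cNand (p a) (q a) :=
  Primrec₂.natPair.comp (.const 1) (Primrec₂.natPair.comp hp hq)

/-- The condition that `x` consists of the elements of rank less than `c` that satisfy `p` with the
parameters `v` is arithmetical. -/
theorem Arith.comprehension {x c p : α → ℕ} {v : α → List ℕ} (hx : Primrec x) (hc : Primrec c)
    (hp : Primrec p) (hv : Primrec v) : Arith fun A G a => ∀ y, _root_.memOf G y (x a) ↔
      ordOf A (rankOf G y) (c a) ∧ _root_.satOf G (c a + 1) (p a) (v a ++ [y]) :=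
  Arith.all ((Arith.memOf .snd (hx.comp .fst)).iff ((Arith.rankOf_ord .snd (hc.comp .fst)).and
    (Arith.satOf (Primrec.succ.comp (hc.comp .fst)) (hp.comp .fst)
      (Primrec.list_concat.comp (hv.comp .fst) .snd))))

theorem Arith.params {c : α → ℕ} {v : α → List ℕ} (hc : Primrec c) (hv : Primrec v) :
    Arith fun A G a => ∀ z ∈ v a, ordOf A (rankOf G z) (c a) :=
  Arith.all ((Arith.list_mem .snd (hv.comp .fst)).imp (Arith.rankOf_ord .snd (hc.comp .fst)))

/-- Satisfaction is part of the data and not defined from membership, so every clause quantifies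
only over numbers and finite lists. -/
theorem arith_isHierarchy : Arith fun A G (_ : α) =>
    IsHierarchy (ordOf A) (memOf G) (rankOf G) (satOf G) (relOf G) := by
  have h4b : Primrec fun q : α × ℕ × ℕ × ℕ × List ℕ => q.2.1 := Primrec.fst.comp .snd
  have h4p : Primrec fun q : α × ℕ × ℕ × ℕ × List ℕ => q.2.2.1 :=
    Primrec.fst.comp (Primrec.snd.comp .snd)
  have h4q : Primrec fun q : α × ℕ × ℕ × ℕ × List ℕ => q.2.2.2.1 :=
    Primrec.fst.comp (Primrec.snd.comp (Primrec.snd.comp .snd))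
  have h4v : Primrec fun q : α × ℕ × ℕ × ℕ × List ℕ => q.2.2.2.2 :=
    Primrec.snd.comp (Primrec.snd.comp (Primrec.snd.comp .snd))
  have mem : Arith fun _ G (_ : α) => ∀ x : ℕ × ℕ × ℕ × List ℕ,
      satOf G x.1 (cMem x.2.1 x.2.2.1) x.2.2.2 ↔
        ∃ y : ℕ × ℕ, x.2.2.2[x.2.1]? = some y.1 ∧ x.2.2.2[x.2.2.1]? = some y.2 ∧
          memOf G y.1 y.2 := by
    refine Arith.all (Arith.iff (Arith.satOf h4b
      (Primrec₂.natPair.comp (.const 0) (Primrec₂.natPair.comp h4p h4q)) h4v) (Arith.ex ?_))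
    have h1 : Primrec fun q : (α × ℕ × ℕ × ℕ × List ℕ) × ℕ × ℕ => q.2.1 := Primrec.fst.comp .snd
    have h2 : Primrec fun q : (α × ℕ × ℕ × ℕ × List ℕ) × ℕ × ℕ => q.2.2 := Primrec.snd.comp .snd
    exact (Arith.eq (Primrec.list_getElem?.comp (h4v.comp .fst) (h4p.comp .fst))
      (Primrec.option_some.comp h1)).and ((Arith.eq (Primrec.list_getElem?.comp (h4v.comp .fst)
        (h4q.comp .fst)) (Primrec.option_some.comp h2)).and (Arith.memOf h1 h2))
  have nand : Arith fun _ G (_ : α) => ∀ x : ℕ × ℕ × ℕ × List ℕ,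
      satOf G x.1 (cNand x.2.1 x.2.2.1) x.2.2.2 ↔
        ¬ (satOf G x.1 x.2.1 x.2.2.2 ∧ satOf G x.1 x.2.2.1 x.2.2.2) :=
    Arith.all (Arith.iff (Arith.satOf h4b (primrec_cNand h4p h4q) h4v)
      ((Arith.satOf h4b h4p h4v).and (Arith.satOf h4b h4q h4v)).not)
  have rel : Arith fun _ G (_ : α) => ∀ x : ℕ × ℕ × ℕ × List ℕ,
      satOf G x.1 (cRel x.2.1 x.2.2.1) x.2.2.2 ↔
        x.1 = 0 ∧ relOf G x.2.1 (lookups x.2.2.1 x.2.2.2) :=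
    Arith.all (Arith.iff (Arith.satOf h4b
      (Primrec₂.natPair.comp (Primrec.nat_add.comp h4p (.const 3)) h4q) h4v)
      ((Arith.eq h4b (.const 0)).and (Arith.relOf h4p (primrec_lookups h4q h4v))))
  have h3b : Primrec fun q : α × ℕ × ℕ × List ℕ => q.2.1 := Primrec.fst.comp .snd
  have h3p : Primrec fun q : α × ℕ × ℕ × List ℕ => q.2.2.1 :=
    Primrec.fst.comp (Primrec.snd.comp .snd)
  have h3v : Primrec fun q : α × ℕ × ℕ × List ℕ => q.2.2.2 :=
    Primrec.snd.comp (Primrec.snd.comp .snd)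
  have all : Arith fun A G (_ : α) => ∀ x : ℕ × ℕ × List ℕ,
      satOf G x.1 (cAll x.2.1) x.2.2 ↔
        ∀ y, InLevel (ordOf A) (rankOf G) x.1 y → satOf G x.1 x.2.1 (x.2.2 ++ [y]) :=
    Arith.all (Arith.iff (Arith.satOf h3b (Primrec₂.natPair.comp (.const 2) h3p) h3v)
      (Arith.all ((Arith.inLevel (h3b.comp .fst) .snd).imp (Arith.satOf (h3b.comp .fst)
        (h3p.comp .fst) (Primrec.list_concat.comp (h3v.comp .fst) .snd)))))
  have h2x : Primrec fun q : α × ℕ × ℕ => q.2.1 := Primrec.fst.comp .snd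
  have h2y : Primrec fun q : α × ℕ × ℕ => q.2.2 := Primrec.snd.comp .snd
  have ext : Arith fun _ G (_ : α) => ∀ x : ℕ × ℕ,
      (∀ z, memOf G z x.1 ↔ memOf G z x.2) → x.1 = x.2 :=
    Arith.all (Arith.imp (Arith.all (Arith.iff (Arith.memOf .snd (h2x.comp .fst))
      (Arith.memOf .snd (h2y.comp .fst)))) (Arith.eq h2x h2y))
  -- The rank of `x` is named by the quantified component `q.1` to avoid nested oracle values.
  have definable : Arith fun A G (_ : α) => ∀ x : ℕ, ∃ q : ℕ × ℕ × List ℕ,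
      rankOf G x = q.1 ∧ (∀ z ∈ q.2.2, ordOf A (rankOf G z) q.1) ∧
      ∀ y, memOf G y x ↔ ordOf A (rankOf G y) q.1 ∧ satOf G (q.1 + 1) q.2.1 (q.2.2 ++ [y]) := by
    refine Arith.all (Arith.ex ?_)
    have hx : Primrec fun q : (α × ℕ) × ℕ × ℕ × List ℕ => q.1.2 := Primrec.snd.comp .fst
    have hc : Primrec fun q : (α × ℕ) × ℕ × ℕ × List ℕ => q.2.1 := Primrec.fst.comp .snd
    have hp : Primrec fun q : (α × ℕ) × ℕ × ℕ × List ℕ => q.2.2.1 :=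
      Primrec.fst.comp (Primrec.snd.comp .snd)
    have hv : Primrec fun q : (α × ℕ) × ℕ × ℕ × List ℕ => q.2.2.2 :=
      Primrec.snd.comp (Primrec.snd.comp .snd)
    exact (Arith.rankOf_eq hx hc).and ((Arith.params hc hv).and (Arith.comprehension hx hc hp hv))
  have comprehension : Arith fun A G (_ : α) => ∀ q : ℕ × ℕ × List ℕ,
      (∀ z ∈ q.2.2, ordOf A (rankOf G z) q.1) → ∃ x, (rankOf G x = q.1 ∨
        ordOf A (rankOf G x) q.1) ∧
      ∀ y, memOf G y x ↔ ordOf A (rankOf G y) q.1 ∧ satOf G (q.1 + 1) q.2.1 (q.2.2 ++ [y]) :=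
    Arith.all ((Arith.params h3b h3v).imp (Arith.ex (((Arith.rankOf_eq .snd (h3b.comp .fst)).or
      (Arith.rankOf_ord .snd (h3b.comp .fst))).and
      (Arith.comprehension .snd (h3b.comp .fst) (h3p.comp .fst) (h3v.comp .fst)))))
  refine (mem.and (nand.and (all.and (rel.and (ext.and
    (definable.and comprehension)))))).of_iff fun A G _ => ?_
  simp only [Prod.forall, Prod.exists]
  constructor
  · rintro ⟨h1, h2, h3, h4, h5, h6, h7⟩
    refine ⟨h1, h2, h3, h4, h5, fun x => ?_, h7⟩
    obtain ⟨p, v, h⟩ := h6 x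
    exact ⟨_, p, v, rfl, h⟩
  · rintro ⟨h1, h2, h3, h4, h5, h6, h7⟩
    refine ⟨h1, h2, h3, h4, h5, fun x => ?_, h7⟩
    obtain ⟨_, p, v, rfl, h⟩ := h6 x
    exact ⟨p, v, h⟩

/-- The matrix of the `Σ¹₁` definition, over copies of `α`, of truth in the structure `L_α` of the
`Σ¹₁` formula with code `p` at the level `L_β`, where `n` represents `β`. -/
def Truth (A : Set ℕ) (G : ℕ → ℕ) (p n : ℕ) : Prop :=
  IsHierarchy (ordOf A) (memOf G) (rankOf G) (satOf G) (relOf G) ∧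
    ∃ w, (∀ y, memOf G y w ↔ ordOf A (rankOf G y) n) ∧ satOf G 0 p [w]

theorem arith_truth {p n : α → ℕ} (hp : Primrec p) (hn : Primrec n) :
    Arith fun A G a => Truth A G (p a) (n a) :=
  arith_isHierarchy.and (Arith.ex ((Arith.all ((Arith.memOf .snd (Primrec.snd.comp .fst)).iff
    (Arith.rankOf_ord .snd (hn.comp (Primrec.fst.comp .fst))))).and (Arith.satOf (.const 0)
      (hp.comp .fst) (Primrec.list_cons.comp .snd (.const [])))))

end Coding

/-! ### Truth at a level read off from a copy, and the main theorem. -/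

theorem exists_truth_iff {α : Ordinal.{u}} {r : ℕ → ℕ → Prop}
    (o : r ≃r fun a b : Set.Iio α => a < b) {p n : ℕ} :
    (∃ G, Truth (atomicDiagram r) G p n) ↔
      ∃ X, Sat (· ∈ constructibleLevel α) X p [constructibleLevel (o n)] := by
  have hr : ordOf (atomicDiagram r) = r := by
    funext a b
    simp [ordOf, atomicDiagram]
  rw [← exists_isHierarchy_iff o]
  simp only [Truth, hr]
  constructor
  · rintro ⟨G, h, w, hw⟩
    exact ⟨_, _, _, _, w, h, hw⟩
  · rintro ⟨E, ρ, S, Y, w, h⟩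
    obtain ⟨G, rfl, rfl, rfl, rfl⟩ := exists_coding E ρ S Y
    exact ⟨G, h.1, w, h.2⟩

theorem exists_code_of_sigma11 {M : ZFSet.{u}} (hM : ∀ x ∈ M, ∀ y ∈ x, y ∈ M)
    (ψ : (setLang.sum relVarLang).Formula Unit) :
    ∃ p, ∀ a : M, Sigma11Holds M ψ a ↔ ∃ X, Sat (· ∈ M) X p [(a : ZFSet.{u})] := by
  obtain ⟨p, hp⟩ := exists_code.{u} (fun _ : Unit => 0) 1 ψ
  refine ⟨p, fun a => ?_⟩
  have h := fun X => hp M hM X [(a : ZFSet.{u})] (fun _ => a) default rfl (by simp)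
  simp only [List.ofFn_zero, List.append_nil] at h
  constructor
  · rintro ⟨S, hS⟩
    obtain ⟨X, rfl⟩ := exists_relStructure_eq M S
    exact ⟨X, (h X).1 hS⟩
  · rintro ⟨X, hX⟩
    exact ⟨relStructure M X, (h X).2 hX⟩

theorem mem_setJoin_left {X Y : Set ℕ} {n : ℕ} : 2 * n ∈ setJoin X Y ↔ n ∈ X := by
  constructor
  · rintro (⟨m, hm, h⟩ | ⟨m, hm, h⟩)
    · obtain rfl : n = m := by omega
      exact hm
    · omega
  · exact fun h => .inl ⟨n, h, rfl⟩

theorem mem_setJoin_right {X Y : Set ℕ} {n : ℕ} : 2 * n + 1 ∈ setJoin X Y ↔ n ∈ Y := by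
  constructor
  · rintro (⟨m, hm, h⟩ | ⟨m, hm, h⟩)
    · omega
    · obtain rfl : n = m := by omega
      exact hm
  · exact fun h => .inr ⟨n, h, rfl⟩

theorem mainTheorem6 (α : Ordinal.{u}) (hα : OrdinalSigma11PD α) :
    Clarifies kleeneO (copiesOf α) := by
  rintro r ⟨o⟩ s ⟨o'⟩ -
  refine ⟨o.trans o'.symm, ?_⟩
  obtain ⟨g, hg, hgO⟩ := (arith_truth (α := ℕ × ℕ) .fst .snd).1.exists_reduction
  -- The number `g' (p, n)` lies in `𝒪` when `p` holds at no element other than `n`; this is the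
  -- uniqueness query.
  obtain ⟨g', hg', hgO'⟩ := Sig.exists_reduction (α := ℕ × ℕ)
    (R := fun A G x => ∃ m, m ≠ x.2 ∧ Truth A G x.1 m)
    (Arith.ex ((Arith.eq .snd (Primrec.snd.comp .fst)).not.and
      (arith_truth (Primrec.fst.comp .fst) .snd))).1
  have hw : Primrec fun z : ℕ => z.unpair.2.unpair :=
    Primrec.unpair.comp (Primrec.snd.comp Primrec.unpair)
  have hn : Primrec fun z : ℕ => (z.unpair.2.unpair.1, z.unpair.1) :=
    (Primrec.fst.comp hw).pair (Primrec.fst.comp Primrec.unpair)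
  -- The witness is the pair of a code `p` and a candidate image `m`. Even queries go to `𝒪` of the
  -- first copy (truth at `n`, uniqueness of `n`), the odd one to `𝒪` of the second (truth at `m`).
  -- Truth corresponds to non-membership.
  refine computableIn_of_search
    (g₁ := fun z => 2 * g (z.unpair.2.unpair.1, z.unpair.1))
    (g₂ := fun z => 2 * g' (z.unpair.2.unpair.1, z.unpair.1))
    (g₃ := fun z => 2 * g z.unpair.2.unpair + 1)
    (Primrec.nat_mul.comp (.const 2) (hg.comp hn)) (Primrec.nat_mul.comp (.const 2) (hg'.comp hn))
    (Primrec.succ.comp (Primrec.nat_mul.comp (.const 2) (hg.comp hw))) (fun n => ?_)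
    fun n w => ?_
  all_goals
    simp only [mem_setJoin_left, mem_setJoin_right, hgO, hgO', Nat.unpair_pair, not_not]
  · obtain ⟨ψ, hψ⟩ := hα ⟨_, constructibleLevel_mem (o n).2⟩
    obtain ⟨p, hp⟩ := exists_code_of_sigma11 constructibleLevel_transitive ψ
    have hval : ∀ δ : Set.Iio α,
        (∃ X, Sat (· ∈ constructibleLevel α) X p [constructibleLevel δ]) ↔ δ = o n := by
      intro δ
      rw [← hp ⟨_, constructibleLevel_mem δ.2⟩]
      refine (Set.ext_iff.1 hψ _).trans ?_
      rw [Set.mem_singleton_iff, Subtype.mk.injEq, constructibleLevel_injective.eq_iff,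
        Subtype.coe_inj]
    refine ⟨Nat.pair p (o'.symm (o n)), ?_⟩
    simp only [Nat.unpair_pair]
    refine ⟨(exists_truth_iff o).2 ((hval _).2 rfl), ?_, (exists_truth_iff o').2 ((hval _).2 ?_)⟩
    · rintro ⟨G, m, hm, hG⟩
      exact hm (o.injective ((hval _).1 ((exists_truth_iff o).1 ⟨G, hG⟩)))
    · exact o'.apply_symm_apply _
  · intro _ h2 h3
    -- Truth at `m` in the second copy transfers to the element of the first copy with the same
    -- ordinal; were that element not `n`, the uniqueness query would fail.
    have h4 := (exists_truth_iff o').1 h3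
    by_contra hne
    have h5 : o (o.symm (o' w.unpair.2)) = o' w.unpair.2 := o.apply_symm_apply _
    rw [← h5, ← exists_truth_iff o] at h4
    obtain ⟨G, hG⟩ := h4
    refine h2 ⟨G, _, fun h => hne ?_, hG⟩
    rw [RelIso.trans_apply, ← h, h5, RelIso.symm_apply_apply]
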